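/- Let $G$ be a finite simple graph with maximum degree at most $3$ (a subcubic graph). Its maximum average degree is $\mathrm{mad}(G)=\max\left\{\frac{2|E(H)|}{|V(H)|} : H\subseteq G\right\}$, the maximum being over the subgraphs $H$ of $G$ with at least one vertex (and $\mathrm{mad}(G)=0$ if $G$ has no vertices). Three edges $e_1,e_2,e_3$ of $G$ are consecutive if they form, in this order, a path or a cycle of length three. An injective edge-coloring of $G$ is a coloring $c$ of the edges of $G$ (not necessarily proper) such that $c(e_1)\neq c(e_3)$ whenever $e_1,e_2,e_3$ are consecutive edges of $G$, and the injective chromatic index $\chi'_{\mathrm{inj}}(G)$ is the minimum number of colors in an injective edge-coloring of $G$. Then: 1. if $\mathrm{mad}(G)<\frac{7}{3}$, then $\chi'_{\mathrm{inj}}(G)\leq 4$; 2. if $\mathrm{mad}(G)<\frac{8}{3}$, then $\chi'_{\mathrm{inj}}(G)\leq 6$; 3. if $\mathrm{mad}(G)<3$, then $\chi'_{\mathrm{inj}}(G)\leq 7$. -/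

import Mathlib

namespace SimpleGraph

variable {V : Type*}

/-- Three edges `e₁, e₂, e₃` of `G` are consecutive if they form, in this order, a path
`a - b - c - d` with three edges (the case `a ≠ d`) or a cycle of length three (the case `a = d`).
The vertices of adjacent pairs are distinct because they are joined by edges of `G`. -/
def ConsecutiveEdges (G : SimpleGraph V) (e₁ e₂ e₃ : G.edgeSet) : Prop :=
  ∃ a b c d : V, a ≠ c ∧ b ≠ d ∧
    (e₁ : Sym2 V) = s(a, b) ∧ (e₂ : Sym2 V) = s(b, c) ∧ (e₃ : Sym2 V) = s(c, d)

/-- An edge-coloring is injective if the first and the last of any three consecutive edges receive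
different colors. It need not be a proper edge-coloring. -/
def EdgeLabeling.IsInjectiveColoring {G : SimpleGraph V} {K : Type*} (c : G.EdgeLabeling K) :
    Prop :=
  ∀ e₁ e₂ e₃ : G.edgeSet, G.ConsecutiveEdges e₁ e₂ e₃ → c e₁ ≠ c e₃

/-- `G` has an injective edge-coloring with colors from a set of `k` colors. -/
def InjectivelyEdgeColorable (G : SimpleGraph V) (k : ℕ) : Prop :=
  ∃ c : G.EdgeLabeling (Fin k), c.IsInjectiveColoring

/-- The injective chromatic index: the least number of colors in an injective edge-coloring
(`⊤` if no finite number of colors suffices, which does not occur for finite graphs). -/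
noncomputable def injectiveChromaticIndex (G : SimpleGraph V) : ℕ∞ :=
  ⨅ (k : ℕ) (_ : G.InjectivelyEdgeColorable k), (k : ℕ∞)

/-- The maximum average degree of a finite graph: the maximum of `2 |E(H)| / |V(H)|` over the
subgraphs `H` of `G`. The subgraph without vertices contributes the value `0 / 0 = 0`, which changes
nothing: every other subgraph contributes a nonnegative value. -/
noncomputable def maxAverageDegree (G : SimpleGraph V) : ℝ :=
  ⨆ H : G.Subgraph, 2 * (H.edgeSet.ncard : ℝ) / (H.verts.ncard : ℝ)

/-- For a finite graph the supremum in the definition is a maximum. -/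
theorem isGreatest_maxAverageDegree [Finite V] (G : SimpleGraph V) :
    IsGreatest (Set.range fun H : G.Subgraph =>
      2 * (H.edgeSet.ncard : ℝ) / (H.verts.ncard : ℝ)) G.maxAverageDegree := by
  have hfin : Finite G.Subgraph :=
    Finite.of_injective (fun H : G.Subgraph => (H.verts, H.Adj)) (by
      intro H H' h
      simp only [Prod.mk.injEq] at h
      exact Subgraph.ext h.1 h.2)
  exact ⟨(Set.range_nonempty _).csSup_mem (Set.finite_range _),
    fun x hx => le_csSup (Set.finite_range _).bddAbove hx⟩

end SimpleGraph

/-! All three bounds are proved by reducible configurations and counting. Induction runs over the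
subgraphs `H ≤ G`: if deleting the edges at a suitable vertex set leaves a graph whose coloring
extends to `H`, that set is reducible. In a counterexample no such set occurs, and this forces an
average degree at or above the assumed bound.

For six and seven colors the extension is greedy: an edge `uv` conflicts only with edges one step
beyond `u` or `v`, so at most eight in a subcubic graph and fewer near vertices of degree at most
two. Below 3, some vertex has degree one or two, and seven colors suffice there. With six colors,
leaves, adjacent 2-vertices and 3-vertices with two 2-neighbors are reducible; without them `2 n₂ ≤
n₃`, where `n₂` and `n₃` count the vertices of degree two and three, so the average is at least
`8/3`.

With four colors greedy extension fails, and the induction hypothesis is strengthened: every vertex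
of degree below three also carries a loop, colored like a pendant edge. Deleting `D` gives each
outside neighbor of `D` such a loop, and its color is reused for the restored edges to `D`. As
incident edges may share a color, one loop serves several restored edges. Hence nothing outside `D`
changes (`IsSlotColoring.recolor`), and each edge leaving `D` imposes only its own color and a pair
of colors allowed inside. Finite checks then reduce leaves, triangles with two 2-vertices, paths of
three 2-vertices, and a spider. Discharging in `exists_isSlotColoring` shows that avoiding all of
these gives average at least `7/3`. -/

namespace SimpleGraph

/-! ### Induction on subgraphs and the density bound -/

section Injective

/-- Deleting all edges that touch `D`, keeping the vertices. -/
def isolate {V : Type*} (H : SimpleGraph V) (D : Set V) : SimpleGraph V where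
  Adj a b := H.Adj a b ∧ a ∉ D ∧ b ∉ D
  symm := ⟨fun _ _ h => ⟨h.1.symm, h.2.2, h.2.1⟩⟩
  loopless := ⟨fun a h => H.loopless.irrefl a h.1⟩

variable {V : Type*}

theorem isolate_le (H : SimpleGraph V) (D : Set V) : H.isolate D ≤ H := fun _ _ h => h.1

theorem isolate_lt {H : SimpleGraph V} {D : Set V} {v w : V} (hv : v ∈ D) (h : H.Adj v w) :
    H.isolate D < H :=
  lt_of_le_not_ge (H.isolate_le D) fun hle => (hle h).2.1 hv

/-- If every nonempty edge set below `G` exposes a reducible configuration, then induction on the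
subgraph shows that `P` holds for `G`. -/
theorem induction_of_isolate [Finite V] {G : SimpleGraph V} {P : SimpleGraph V → Prop}
    (step : ∀ H ≤ G, (∀ K < H, P K) → P H) : P G := by
  have : ∀ H : SimpleGraph V, H ≤ G → P H := by
    intro H
    induction H using WellFoundedLT.induction with
    | ind H ih => exact fun hH => step H hH fun K hK => ih K hK (hK.le.trans hH)
  exact this G le_rfl

/-- A coloring of all unordered pairs that is injective on the edges gives an injective coloring. -/
theorem injectiveChromaticIndex_le {G : SimpleGraph V} {k : ℕ} (c : Sym2 V → Fin k)
    (hc : ∀ a b x y, G.Adj a b → G.Adj b x → G.Adj x y → a ≠ x → b ≠ y →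
      c s(a, b) ≠ c s(x, y)) : G.injectiveChromaticIndex ≤ k := by
  refine iInf₂_le k ⟨fun e => c e, ?_⟩
  rintro ⟨e₁, h₁⟩ ⟨e₂, h₂⟩ ⟨e₃, h₃⟩ ⟨a, b, x, y, hax, hby, rfl, rfl, rfl⟩
  exact hc a b x y h₁ h₂ h₃ hax hby

variable [Fintype V]

open scoped Classical in
/-- The degree sum of a subgraph is bounded through the maximum average degree. -/
theorem sum_degree_lt_of_maxAverageDegree_lt {G H : SimpleGraph V} (hH : H ≤ G) {p q : ℕ}
    (hq : 0 < q) (hG : G.maxAverageDegree < (p : ℝ) / q) {u v : V} (huv : H.Adj u v) :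
    q * ∑ x, H.degree x < p * (Finset.univ.filter fun x => 0 < H.degree x).card := by
  -- Deletion keeps isolated vertices, which would dilute the average, so the density is tested on
  -- the support of `H`.
  let K : G.Subgraph :=
    { verts := H.support
      Adj := H.Adj
      adj_sub := fun h => hH h
      edge_vert := fun h => ⟨_, h⟩
      symm := H.symm }
  have h1 : 2 * (K.edgeSet.ncard : ℝ) / (K.verts.ncard : ℝ) ≤ G.maxAverageDegree :=
    G.isGreatest_maxAverageDegree.2 ⟨K, rfl⟩
  have hverts : K.verts.ncard = (Finset.univ.filter fun x => 0 < H.degree x).card := by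
    rw [← Set.ncard_coe_finset]
    congr 1
    ext x
    simp [K, H.degree_pos_iff_exists_adj, mem_support]
  have hedge : K.edgeSet = (H.edgeFinset : Set (Sym2 V)) := by
    ext e
    induction e with
    | _ a b => simp [K]
  rw [hedge, Set.ncard_coe_finset, hverts] at h1
  have hpos : 0 < (Finset.univ.filter fun x => 0 < H.degree x).card :=
    Finset.card_pos.2 ⟨u, by simpa [H.degree_pos_iff_exists_adj] using ⟨v, huv⟩⟩
  rw [H.sum_degrees_eq_twice_card_edges]
  have h2 := h1.trans_lt hG
  rw [div_lt_div_iff₀ (by exact_mod_cast hpos) (by exact_mod_cast hq)] at h2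
  rw [mul_comm]
  exact_mod_cast h2

end Injective

/-! ### Conflicts between edges and greedy extension -/

section Greedy

variable {V : Type*} {k : ℕ}

/-- Two pairs of vertices conflict if they are the outer edges of three consecutive edges. -/
def Conflict (H : SimpleGraph V) (e f : Sym2 V) : Prop :=
  ∃ a b x y, H.Adj a b ∧ H.Adj b x ∧ H.Adj x y ∧ a ≠ x ∧ b ≠ y ∧ e = s(a, b) ∧ f = s(x, y)

theorem Conflict.symm {H : SimpleGraph V} {e f : Sym2 V} (h : H.Conflict e f) :
    H.Conflict f e := by
  obtain ⟨a, b, x, y, h1, h2, h3, h4, h5, rfl, rfl⟩ := h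
  exact ⟨y, x, b, a, h3.symm, h2.symm, h1.symm, h5.symm, h4.symm, Sym2.eq_swap, Sym2.eq_swap⟩

theorem Conflict.ne {H : SimpleGraph V} {e f : Sym2 V} (h : H.Conflict e f) : e ≠ f := by
  obtain ⟨a, b, x, y, h1, h2, h3, h4, h5, rfl, rfl⟩ := h
  intro h
  rcases Sym2.eq_iff.1 h with ⟨h, -⟩ | ⟨-, h⟩
  · exact h4 h
  · exact h2.ne h

/-- `c` gives different colors to conflicting edges of the edge set `T`. -/
def ColorsOn (H : SimpleGraph V) (T : Set (Sym2 V)) (c : Sym2 V → Fin k) : Prop :=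
  ∀ e ∈ T, ∀ f ∈ T, H.Conflict e f → c e ≠ c f

theorem ColorsOn.mono {H : SimpleGraph V} {T T' : Set (Sym2 V)} {c : Sym2 V → Fin k}
    (hc : H.ColorsOn T c) (h : T' ⊆ T) : H.ColorsOn T' c :=
  fun e he f hf => hc e (h he) f (h hf)

/-- The middle edge of a conflict joins endpoints of the outer edges, so if both outer edges avoid
`v`, the whole conflict survives the deletion. -/
theorem ColorsOn.of_isolate {H : SimpleGraph V} {v : V} {c : Sym2 V → Fin k}
    (hc : (H.isolate {v}).ColorsOn (H.isolate {v}).edgeSet c) :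
    H.ColorsOn {e | e ∈ H.edgeSet ∧ v ∉ e} c := by
  rintro _ he _ hf ⟨a, b, x, y, h1, h2, h3, h4, h5, rfl, rfl⟩
  simp only [Set.mem_ofPred_eq, Sym2.mem_iff, not_or] at he hf
  have k1 : (H.isolate {v}).Adj a b := ⟨h1, Ne.symm he.2.1, Ne.symm he.2.2⟩
  have k2 : (H.isolate {v}).Adj b x := ⟨h2, Ne.symm he.2.2, Ne.symm hf.2.1⟩
  have k3 : (H.isolate {v}).Adj x y := ⟨h3, Ne.symm hf.2.1, Ne.symm hf.2.2⟩
  exact hc _ k1 _ k3 ⟨a, b, x, y, k1, k2, k3, h4, h5, rfl, rfl⟩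

/-- A further edge can be colored if fewer than `k` colored edges conflict with it. -/
theorem ColorsOn.exists_insert {H : SimpleGraph V} {T : Set (Sym2 V)} {c : Sym2 V → Fin k}
    (hc : H.ColorsOn T c) (e : Sym2 V) (F : Finset (Sym2 V))
    (hF : ∀ f ∈ T, H.Conflict e f → f ∈ F) (hk : F.card < k) :
    ∃ c' : Sym2 V → Fin k, H.ColorsOn (insert e T) c' := by
  classical
  obtain ⟨t, ht⟩ : ∃ t, t ∉ F.image c := by
    by_contra! h
    have : (Finset.univ : Finset (Fin k)) ⊆ F.image c := fun t _ => h t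
    have := (Finset.card_le_card this).trans Finset.card_image_le
    simp at this
    omega
  have key : ∀ f ∈ T, H.Conflict e f → c f ≠ t := fun f hf h h' =>
    ht (h' ▸ Finset.mem_image_of_mem c (hF f hf h))
  refine ⟨Function.update c e t, ?_⟩
  intro f hf g hg hfg
  by_cases h1 : f = e
  · subst h1
    have h2 : g ≠ f := hfg.ne.symm
    simp only [Function.update_self, Function.update_of_ne h2]
    exact (key g (hg.resolve_left h2) hfg).symm
  · by_cases h2 : g = e
    · subst h2
      simp only [Function.update_self, Function.update_of_ne h1]
      exact key f (hf.resolve_left h1) hfg.symm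
    · simp only [Function.update_of_ne h1, Function.update_of_ne h2]
      exact hc f (hf.resolve_left h1) g (hg.resolve_left h2) hfg

variable [Fintype V]

open scoped Classical in
/-- The edges reached from `v` by a walk through a neighbor of `v` that avoids the edge `v u`. -/
noncomputable def beyond (H : SimpleGraph V) (u v : V) : Finset (Sym2 V) :=
  ((H.neighborFinset v).erase u).biUnion fun x => ((H.neighborFinset x).erase v).image fun y => s(x, y)

open scoped Classical in
theorem Conflict.mem_beyond {H : SimpleGraph V} {u v : V} {f : Sym2 V}
    (h : H.Conflict s(u, v) f) : f ∈ H.beyond u v ∪ H.beyond v u := by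
  obtain ⟨a, b, x, y, h1, h2, h3, h4, h5, he, rfl⟩ := h
  have key : ∀ a b, H.Adj b x → a ≠ x → b ≠ y → s(x, y) ∈ H.beyond a b := by
    intro a b h2 h4 h5
    simp only [beyond, Finset.mem_biUnion, Finset.mem_erase, mem_neighborFinset, Finset.mem_image]
    exact ⟨x, ⟨h4.symm, h2⟩, y, ⟨h5.symm, h3⟩, rfl⟩
  rcases Sym2.eq_iff.1 he with ⟨rfl, rfl⟩ | ⟨rfl, rfl⟩
  · exact Finset.mem_union_left _ (key _ _ h2 h4 h5)
  · exact Finset.mem_union_right _ (key _ _ h2 h4 h5)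

-- Each of the at most `m` neighbors other than `u` contributes at most `d` edges; the `+ 1` in both
-- bounds is the edge by which the walk arrives.
open scoped Classical in
theorem card_beyond_le {H : SimpleGraph V} {u v : V} (huv : H.Adj u v) {m d : ℕ}
    (hv : H.degree v ≤ m + 1) (hd : ∀ x, H.Adj v x → x ≠ u → H.degree x ≤ d + 1) :
    (H.beyond u v).card ≤ m * d := by
  refine (Finset.card_biUnion_le_card_mul _ _ d fun x hx => ?_).trans ?_
  · simp only [Finset.mem_erase, mem_neighborFinset] at hx
    refine Finset.card_image_le.trans ?_
    rw [Finset.card_erase_of_mem (by simpa using hx.2.symm), card_neighborFinset_eq_degree]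
    have := hd x hx.2 hx.1
    omega
  · rw [Finset.card_erase_of_mem (by simpa using huv.symm), card_neighborFinset_eq_degree]
    exact Nat.mul_le_mul_right _ (by omega)

end Greedy

end SimpleGraph

namespace SimpleGraph

/-! ### Reducible configurations for six and seven colors -/

section Sparse

variable {V : Type*} {k : ℕ} {H : SimpleGraph V}

theorem exists_colorsOn_of_forall_not_adj [NeZero k] (h : ∀ u v, ¬ H.Adj u v) :
    ∃ c : Sym2 V → Fin k, H.ColorsOn H.edgeSet c := by
  refine ⟨fun _ => 0, ?_⟩
  rintro _ - _ - ⟨a, b, x, y, h1, -⟩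
  exact (h _ _ h1).elim

variable [Fintype V]

open scoped Classical in
theorem exists_adj_iff_of_degree_eq_one {v : V} (h : H.degree v = 1) :
    ∃ u, ∀ a, H.Adj v a ↔ a = u := by
  rw [← card_neighborFinset_eq_degree, Finset.card_eq_one] at h
  obtain ⟨u, hu⟩ := h
  exact ⟨u, fun a => by rw [← mem_neighborFinset, hu]; simp⟩

open scoped Classical in
theorem exists_adj_iff_of_degree_eq_two {v : V} (h : H.degree v = 2) :
    ∃ u w, u ≠ w ∧ ∀ a, H.Adj v a ↔ a = u ∨ a = w := by
  rw [← card_neighborFinset_eq_degree, Finset.card_eq_two] at h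
  obtain ⟨u, w, huw, h⟩ := h
  exact ⟨u, w, huw, fun a => by rw [← mem_neighborFinset, h]; simp⟩

open scoped Classical in
theorem exists_adj_iff_of_degree_eq_three {v : V} (h : H.degree v = 3) :
    ∃ u w z, u ≠ w ∧ u ≠ z ∧ w ≠ z ∧ ∀ a, H.Adj v a ↔ a = u ∨ a = w ∨ a = z := by
  rw [← card_neighborFinset_eq_degree, Finset.card_eq_three] at h
  obtain ⟨u, w, z, huw, huz, hwz, h⟩ := h
  exact ⟨u, w, z, huw, huz, hwz, fun a => by rw [← mem_neighborFinset, h]; simp⟩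

open scoped Classical in
theorem exists_adj_iff_of_degree_eq_two_of_adj {v u : V} (h : H.degree v = 2) (hu : H.Adj v u) :
    ∃ w, u ≠ w ∧ ∀ a, H.Adj v a ↔ a = u ∨ a = w := by
  obtain ⟨a, b, hab, h⟩ := exists_adj_iff_of_degree_eq_two h
  rcases (h u).1 hu with rfl | rfl
  · exact ⟨b, hab, h⟩
  · exact ⟨a, hab.symm, fun x => by rw [h, or_comm]⟩

theorem ColorsOn.exists_insert_of_adj {T : Set (Sym2 V)} {c : Sym2 V → Fin k}
    (hc : H.ColorsOn T c) (u v : V)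
    (hk : (H.beyond u v).card + (H.beyond v u).card < k) :
    ∃ c' : Sym2 V → Fin k, H.ColorsOn (insert s(u, v) T) c' := by
  classical
  exact hc.exists_insert _ _ (fun f _ hf => hf.mem_beyond)
    ((Finset.card_union_le _ _).trans_lt hk)

open scoped Classical in
theorem card_beyond_le_add {u v a b : V} (hN : ∀ x, H.Adj v x → x ≠ u → x = a ∨ x = b)
    (ha : H.Adj v a) (hb : H.Adj v b) :
    (H.beyond u v).card ≤ (H.degree a - 1) + (H.degree b - 1) := by
  have key : ∀ x, H.Adj v x →
      (((H.neighborFinset x).erase v).image fun y => s(x, y)).card ≤ H.degree x - 1 := by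
    intro x hx
    refine Finset.card_image_le.trans ?_
    rw [Finset.card_erase_of_mem (by simpa using hx.symm), card_neighborFinset_eq_degree]
  refine le_trans (Finset.card_le_card (t :=
    (((H.neighborFinset a).erase v).image fun y => s(a, y)) ∪
    (((H.neighborFinset b).erase v).image fun y => s(b, y))) ?_)
    ((Finset.card_union_le _ _).trans (add_le_add (key a ha) (key b hb)))
  intro f hf
  simp only [beyond, Finset.mem_biUnion, Finset.mem_erase, mem_neighborFinset] at hf
  obtain ⟨x, ⟨hx1, hx2⟩, hf⟩ := hf
  rcases hN x hx2 hx1 with rfl | rfl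
  · exact Finset.mem_union_left _ hf
  · exact Finset.mem_union_right _ hf

-- Nothing lies beyond the leaf, so its edge has at most four conflicts.
open scoped Classical in
theorem exists_colorsOn_of_degree_le_one (hd : ∀ x, H.degree x ≤ 3) (hk : 4 < k)
    {v u : V} (hv : ∀ a, H.Adj v a ↔ a = u)
    (hc : ∃ c : Sym2 V → Fin k, (H.isolate {v}).ColorsOn (H.isolate {v}).edgeSet c) :
    ∃ c : Sym2 V → Fin k, H.ColorsOn H.edgeSet c := by
  obtain ⟨c, hc⟩ := hc
  have hvu : H.Adj v u := (hv u).2 rfl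
  have h1 : (H.beyond v u).card ≤ 2 * 2 := card_beyond_le hvu (hd u) fun x _ _ => hd x
  have h2 : (H.beyond u v).card ≤ 0 * 2 := by
    refine card_beyond_le hvu.symm ?_ fun x _ _ => hd x
    rw [← card_neighborFinset_eq_degree, Finset.card_le_one]
    simp +contextual [hv]
  obtain ⟨c', hc'⟩ := hc.of_isolate.exists_insert_of_adj v u (by omega)
  refine ⟨c', hc'.mono fun e he => ?_⟩
  by_cases hve : v ∈ e
  · obtain ⟨a, rfl⟩ := hve
    rw [(hv a).1 he]
    exact Set.mem_insert _ _
  · exact Or.inr ⟨he, hve⟩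

open scoped Classical in
/-- A vertex with exactly the neighbors `u` and `w` is removed, and the edges `v u` and `v w` are
colored greedily. -/
theorem exists_colorsOn_of_two_neighbors {v u w : V} (hv : ∀ a, H.Adj v a ↔ a = u ∨ a = w)
    (hu : (H.beyond v u).card + (H.beyond u v).card < k)
    (hw : (H.beyond v w).card + (H.beyond w v).card < k)
    (hc : ∃ c : Sym2 V → Fin k, (H.isolate {v}).ColorsOn (H.isolate {v}).edgeSet c) :
    ∃ c : Sym2 V → Fin k, H.ColorsOn H.edgeSet c := by
  obtain ⟨c, hc⟩ := hc
  obtain ⟨c₁, hc₁⟩ := hc.of_isolate.exists_insert_of_adj v u (by omega)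
  obtain ⟨c₂, hc₂⟩ := hc₁.exists_insert_of_adj v w (by omega)
  refine ⟨c₂, hc₂.mono fun e he => ?_⟩
  by_cases hve : v ∈ e
  · obtain ⟨a, rfl⟩ := hve
    rcases (hv a).1 he with rfl | rfl
    · exact Or.inr (Set.mem_insert _ _)
    · exact Set.mem_insert _ _
  · exact Or.inr (Or.inr ⟨he, hve⟩)

-- Each edge at `v` has at most four conflicts beyond its other end and two beyond `v`.
open scoped Classical in
theorem exists_colorsOn_of_degree_eq_two (hd : ∀ x, H.degree x ≤ 3) (hk : 6 < k)
    {v : V} (hv : H.degree v = 2)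
    (hc : ∃ c : Sym2 V → Fin k, (H.isolate {v}).ColorsOn (H.isolate {v}).edgeSet c) :
    ∃ c : Sym2 V → Fin k, H.ColorsOn H.edgeSet c := by
  obtain ⟨u, w, huw, hN⟩ := exists_adj_iff_of_degree_eq_two hv
  have key : ∀ x, H.Adj v x → (H.beyond v x).card + (H.beyond x v).card < k := by
    intro x hx
    have h1 : (H.beyond v x).card ≤ 2 * 2 := card_beyond_le hx (hd x) fun x _ _ => hd x
    have h2 : (H.beyond x v).card ≤ 1 * 2 := card_beyond_le hx.symm hv.le fun x _ _ => hd x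
    omega
  exact exists_colorsOn_of_two_neighbors hN (key u ((hN u).2 (.inl rfl)))
    (key w ((hN w).2 (.inr rfl))) hc

-- The second 2-vertex saves conflicts: the edge `v u` has at most `2 + 2`, the other edge at `v` at
-- most `4 + 1`.
open scoped Classical in
theorem exists_colorsOn_of_adj_degree_eq_two (hd : ∀ x, H.degree x ≤ 3) (hk : 5 < k)
    {v u : V} (hv : H.degree v = 2) (hu : H.degree u = 2) (hvu : H.Adj v u)
    (hc : ∃ c : Sym2 V → Fin k, (H.isolate {v}).ColorsOn (H.isolate {v}).edgeSet c) :
    ∃ c : Sym2 V → Fin k, H.ColorsOn H.edgeSet c := by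
  obtain ⟨w, huw, hN⟩ := exists_adj_iff_of_degree_eq_two_of_adj hv hvu
  have hvw : H.Adj v w := (hN w).2 (.inr rfl)
  have h1 : (H.beyond v u).card ≤ 1 * 2 := card_beyond_le hvu hu.le fun x _ _ => hd x
  have h2 : (H.beyond u v).card ≤ 1 * 2 := card_beyond_le hvu.symm hv.le fun x _ _ => hd x
  have h3 : (H.beyond v w).card ≤ 2 * 2 := card_beyond_le hvw (hd w) fun x _ _ => hd x
  have h4 : (H.beyond w v).card ≤ 1 * 1 := by
    refine card_beyond_le hvw.symm hv.le fun x hx hxw => ?_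
    rw [((hN x).1 hx).resolve_right hxw]
    exact hu.le
  exact exists_colorsOn_of_two_neighbors hN (by omega) (by omega) hc

-- The edge `x v₂` is uncolored as well and colored last. The edge `v₁ w` then has at most `4 + 2 -
-- 1` colored conflicts, while `v₁ x` and `x v₂` each have at most `(1 + 2) + 2`.
open scoped Classical in
theorem exists_colorsOn_of_two_neighbors_degree_eq_two (hd : ∀ x, H.degree x ≤ 3) (hk : 5 < k)
    {x v₁ v₂ y : V} (hx : ∀ a, H.Adj x a ↔ a = v₁ ∨ a = v₂ ∨ a = y) (hne : v₁ ≠ v₂)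
    (hv₁ : H.degree v₁ = 2) (hv₂ : H.degree v₂ = 2)
    (hc : ∃ c : Sym2 V → Fin k, (H.isolate {v₁}).ColorsOn (H.isolate {v₁}).edgeSet c) :
    ∃ c : Sym2 V → Fin k, H.ColorsOn H.edgeSet c := by
  obtain ⟨c, hc⟩ := hc
  have hx₁ : H.Adj x v₁ := (hx _).2 (.inl rfl)
  have hx₂ : H.Adj x v₂ := (hx _).2 (.inr (.inl rfl))
  have hxy : H.Adj x y := (hx _).2 (.inr (.inr rfl))
  obtain ⟨w, hxw, hN⟩ := exists_adj_iff_of_degree_eq_two_of_adj hv₁ hx₁.symm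
  have hvw : H.Adj v₁ w := (hN w).2 (.inr rfl)
  have hy := hd y
  have h1 : (H.beyond v₁ w).card ≤ 2 * 2 := card_beyond_le hvw (hd w) fun x _ _ => hd x
  have h2 : (H.beyond w v₁).card ≤ 1 * 2 := card_beyond_le hvw.symm hv₁.le fun x _ _ => hd x
  have h3 : s(x, v₂) ∈ H.beyond w v₁ := by
    simp only [beyond, Finset.mem_biUnion, Finset.mem_erase, mem_neighborFinset, Finset.mem_image]
    exact ⟨x, ⟨hxw, hx₁.symm⟩, v₂, ⟨hne.symm, hx₂⟩, rfl⟩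
  have h4 : (H.beyond x v₁).card ≤ 1 * 2 := card_beyond_le hx₁ hv₁.le fun x _ _ => hd x
  have h5 : (H.beyond x v₂).card ≤ 1 * 2 := card_beyond_le hx₂ hv₂.le fun x _ _ => hd x
  have h6 := card_beyond_le_add (u := v₁) (v := x) (a := v₂) (b := y)
    (fun a ha h => ((hx a).1 ha).resolve_left h) hx₂ hxy
  have h7 := card_beyond_le_add (u := v₂) (v := x) (a := v₁) (b := y)
    (fun a ha h => by have := (hx a).1 ha; tauto) hx₁ hxy
  have hc₀ : H.ColorsOn ({e | e ∈ H.edgeSet ∧ v₁ ∉ e} \ {s(x, v₂)}) c :=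
    hc.of_isolate.mono Set.sdiff_subset
  obtain ⟨c₁, hc₁⟩ := hc₀.exists_insert s(v₁, w)
    (H.beyond v₁ w ∪ (H.beyond w v₁).erase s(x, v₂)) (by
      intro f hf hfc
      rcases Finset.mem_union.1 hfc.mem_beyond with h | h
      · exact Finset.mem_union_left _ h
      · exact Finset.mem_union_right _ (Finset.mem_erase.2 ⟨hf.2, h⟩)) (by
      refine (Finset.card_union_le _ _).trans_lt ?_
      rw [Finset.card_erase_of_mem h3]
      omega)
  obtain ⟨c₂, hc₂⟩ := hc₁.exists_insert_of_adj v₁ x (by omega)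
  obtain ⟨c₃, hc₃⟩ := hc₂.exists_insert_of_adj x v₂ (by omega)
  refine ⟨c₃, hc₃.mono fun e he => ?_⟩
  by_cases hve : v₁ ∈ e
  · obtain ⟨a, rfl⟩ := hve
    rcases (hN a).1 he with rfl | rfl
    · exact Or.inr (Set.mem_insert _ _)
    · exact Or.inr (Or.inr (Set.mem_insert _ _))
  · by_cases hev : e = s(x, v₂)
    · exact Or.inl hev
    · exact Or.inr (Or.inr (Or.inr ⟨⟨he, hve⟩, hev⟩))

open scoped Classical in
theorem sum_degree_eq_of_forall (h : ∀ v, H.degree v = 0 ∨ H.degree v = 2 ∨ H.degree v = 3) :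
    (∑ v, H.degree v = 2 * (Finset.univ.filter fun v => H.degree v = 2).card +
      3 * (Finset.univ.filter fun v => H.degree v = 3).card) ∧
    (Finset.univ.filter fun v => 0 < H.degree v).card =
      (Finset.univ.filter fun v => H.degree v = 2).card +
      (Finset.univ.filter fun v => H.degree v = 3).card := by
  simp only [Finset.card_filter, Finset.mul_sum, ← Finset.sum_add_distrib]
  constructor <;>
  · refine Finset.sum_congr rfl fun v _ => ?_
    rcases h v with h | h | h <;> simp [h]

open scoped Classical in
theorem exists_colorsOn_seven {G : SimpleGraph V} (hd : ∀ x, G.degree x ≤ 3)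
    (hG : G.maxAverageDegree < 3) : ∃ c : Sym2 V → Fin 7, G.ColorsOn G.edgeSet c := by
  refine induction_of_isolate (G := G)
    (P := fun H => ∃ c : Sym2 V → Fin 7, H.ColorsOn H.edgeSet c) fun H hH ih => ?_
  have hdH : ∀ x, H.degree x ≤ 3 := fun x => (degree_le_of_le hH).trans (hd x)
  by_cases he : ∀ u v, ¬ H.Adj u v
  · exact exists_colorsOn_of_forall_not_adj he
  push Not at he
  obtain ⟨u, v, huv⟩ := he
  have hs := sum_degree_lt_of_maxAverageDegree_lt (p := 3) (q := 1) hH one_pos (by simpa using hG)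
    huv
  -- Otherwise every non-isolated vertex has degree at least three, against the density bound.
  have hlow : ∃ x, 0 < H.degree x ∧ H.degree x < 3 := by
    by_contra! h
    rw [one_mul, Finset.card_filter, Finset.mul_sum] at hs
    refine hs.not_ge (Finset.sum_le_sum fun x _ => ?_)
    split_ifs with hx
    · exact h x hx
    · simp
  obtain ⟨x, hx0, hx3⟩ := hlow
  obtain ⟨y, hxy⟩ := (H.degree_pos_iff_exists_adj x).1 hx0
  have hc := ih _ (isolate_lt (Set.mem_singleton x) hxy)
  obtain h1 | h2 : H.degree x = 1 ∨ H.degree x = 2 := by omega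
  · obtain ⟨z, hz⟩ := exists_adj_iff_of_degree_eq_one h1
    exact exists_colorsOn_of_degree_le_one hdH (by norm_num) hz hc
  · exact exists_colorsOn_of_degree_eq_two hdH (by norm_num) h2 hc

open scoped Classical in
theorem exists_colorsOn_six {G : SimpleGraph V} (hd : ∀ x, G.degree x ≤ 3)
    (hG : G.maxAverageDegree < 8 / 3) : ∃ c : Sym2 V → Fin 6, G.ColorsOn G.edgeSet c := by
  refine induction_of_isolate (G := G)
    (P := fun H => ∃ c : Sym2 V → Fin 6, H.ColorsOn H.edgeSet c) fun H hH ih => ?_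
  have hdH : ∀ x, H.degree x ≤ 3 := fun x => (degree_le_of_le hH).trans (hd x)
  by_cases he : ∀ u v, ¬ H.Adj u v
  · exact exists_colorsOn_of_forall_not_adj he
  push Not at he
  obtain ⟨u, v, huv⟩ := he
  have hs := sum_degree_lt_of_maxAverageDegree_lt (p := 8) (q := 3) hH (by norm_num) hG huv
  by_contra hno
  have hc : ∀ {x y}, H.Adj x y →
      ∃ c : Sym2 V → Fin 6, (H.isolate {x}).ColorsOn (H.isolate {x}).edgeSet c :=
    fun {x _} h => ih _ (isolate_lt (Set.mem_singleton x) h)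
  have hdeg : ∀ x, H.degree x = 0 ∨ H.degree x = 2 ∨ H.degree x = 3 := by
    intro x
    have := hdH x
    by_cases h1 : H.degree x = 1
    · obtain ⟨z, hz⟩ := exists_adj_iff_of_degree_eq_one h1
      exact (hno (exists_colorsOn_of_degree_le_one hdH (by norm_num) hz (hc ((hz z).2 rfl)))).elim
    · omega
  have htwo : ∀ x y, H.Adj x y → H.degree x = 2 → H.degree y = 3 := by
    intro x y hxy hx
    rcases hdeg y with h | h | h
    · exact ((H.degree_pos_iff_exists_adj y).2 ⟨x, hxy.symm⟩).ne' h |>.elim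
    · exact (hno (exists_colorsOn_of_adj_degree_eq_two hdH (by norm_num) hx h hxy (hc hxy))).elim
    · exact h
  obtain ⟨hsum, hcard⟩ := sum_degree_eq_of_forall hdeg
  -- Double counting of edges between degrees two and three: both neighbors of a 2-vertex have
  -- degree three, and a 3-vertex has at most one 2-neighbor.
  have hcount := Finset.card_mul_le_card_mul H.Adj
    (s := Finset.univ.filter fun v => H.degree v = 2)
    (t := Finset.univ.filter fun v => H.degree v = 3) (m := 2) (n := 1) (by
      intro x hx
      have hx2 : H.degree x = 2 := by simpa using hx
      rw [← hx2, ← card_neighborFinset_eq_degree]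
      refine Finset.card_le_card fun y hy => ?_
      rw [mem_neighborFinset] at hy
      simp [Finset.bipartiteAbove, hy, htwo x y hy hx2]) (by
      intro x hx
      have hx3 : H.degree x = 3 := by simpa using hx
      rw [Finset.card_le_one]
      intro v₁ h₁ v₂ h₂
      simp only [Finset.bipartiteBelow, Finset.mem_filter, Finset.mem_univ, true_and] at h₁ h₂
      by_contra hne
      obtain ⟨y, hy⟩ : ∃ y, ∀ a, H.Adj x a ↔ a = v₁ ∨ a = v₂ ∨ a = y := by
        obtain ⟨a, b, d, hab, had, hbd, hN⟩ := exists_adj_iff_of_degree_eq_three hx3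
        have k₁ := (hN v₁).1 h₁.2.symm
        have k₂ := (hN v₂).1 h₂.2.symm
        rcases k₁ with rfl | rfl | rfl <;> rcases k₂ with rfl | rfl | rfl <;> first
          | exact (hne rfl).elim
          | exact ⟨a, fun z => (hN z).trans (by tauto)⟩
          | exact ⟨b, fun z => (hN z).trans (by tauto)⟩
          | exact ⟨d, fun z => (hN z).trans (by tauto)⟩
      exact hno (exists_colorsOn_of_two_neighbors_degree_eq_two hdH (by norm_num) hy hne h₁.1 h₂.1
        (hc h₁.2)))
  -- `2 n₂ ≤ n₃` contradicts `3 (2 n₂ + 3 n₃) < 8 (n₂ + n₃)`.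
  omega

end Sparse

end SimpleGraph

namespace SimpleGraph

/-! ### Finite color checks for four colors -/

section FourColors

/-- The first color of the `i`-th pair of distinct colors among four. -/
def pairFst (i : Fin 6) : Fin 4 := ![0, 0, 0, 1, 1, 2] i

/-- The second color of the `i`-th pair of distinct colors among four. -/
def pairSnd (i : Fin 6) : Fin 4 := ![1, 2, 3, 2, 3, 3] i

/-- `x` belongs to the `i`-th pair of colors. -/
def InPair (i : Fin 6) (x : Fin 4) : Prop := x = pairFst i ∨ x = pairSnd i

instance (i : Fin 6) (x : Fin 4) : Decidable (InPair i x) :=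
  inferInstanceAs (Decidable (_ ∨ _))

theorem exists_inPair_avoiding :
    ∀ a a' : Fin 4, ∃ i, ∀ x, InPair i x → x ≠ a ∧ x ≠ a' := by
  decide +kernel

-- For a path `y₁ v₁ v₂ v₃ y₂`: `α`, `β` color the two end edges, `e`, `e'` the inner edges, and
-- `p`, `q`, `r` the loops at `v₁`, `v₂`, `v₃`.
set_option synthInstance.maxHeartbeats 400000 in
set_option synthInstance.maxSize 2000 in
theorem exists_path_colors : ∀ (i j : Fin 6) (α β : Fin 4),
    ∃ e, (InPair i e ∧ e ≠ β) ∧ ∃ e', (InPair j e' ∧ e' ≠ α) ∧ ∃ p, (InPair i p ∧ p ≠ e') ∧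
    ∃ r, (InPair j r ∧ r ≠ e) ∧ ∃ q, q ≠ α ∧ q ≠ β ∧ q ≠ p ∧ q ≠ r := by
  decide +kernel

/-- Bit `16 * e + 4 * e' + s` tells whether an arm of a spider extends: its first edge has color `e`,
the other two edges at the center have colors `e'` and `s`, the outer edge has color `β`, and the
`i`-th pair consists of the colors that are absent behind the outer edge. -/
def armMask (i : Fin 6) (β : Fin 4) : ℕ :=
  [0xffedffedffed0000, 0xffedffed0000ffed, 0xffed0000df6defe5, 0xffedfdadfee9,
    0xfefbfefbfefb0000, 0xfefbb6fb0000eef3, 0xfefb0000fefbfefb, 0xfcbbfefbfee9,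
    0xeff7eff7eff70000, 0xa7f7eff70000eef3, 0xcf770000eff7efe5, 0xeff7eff7eff7,
    0xfdbfb5bfdd3f0000, 0xfdbffdbf0000fdbf, 0xfdbf0000fdbffdbf, 0xfcbbfdadfdbf,
    0x977fdf7fdd3f0000, 0xdf7fdf7f0000df7f, 0xcf770000df6ddf7f, 0xdf7fdf7fdf7f,
    0x977fb5bfb7ff0000, 0xa7f7b6fb0000b7ff, 0xb7ff0000b7ffb7ff, 0xb7ffb7ffb7ff].getD (4 * i + β) 0

/-- The variant of `armMask` with the roles of `e` and `e'` exchanged. -/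
def armMaskSwap (i : Fin 6) (β : Fin 4) : ℕ :=
  [0xfff0fff0eee0ddd0, 0xff0fff0fee0edd0d, 0xf0def0ffe06ed0d5, 0xfff0fde0eae0dd9,
    0xfff0eee0fff0bbb0, 0xfb0ee60eff0fbb03, 0xf0ffe0eef0ffb0bb, 0xfff0cee0bfe0bb9,
    0xeee0fff0fff07770, 0xae0e7f0eff0f7703, 0xc0eef0ff70fe7075, 0xeee0fff0fff0777,
    0xfbd0d5d0bb30fff0, 0xff0fdd0dbb0bff0f, 0xf0ffd0ddb0bbf0ff, 0xfff0cdd0bab0bdf,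
    0x9dd07fd07730fff0, 0xdd0dff0f7707ff0f, 0xc0ddf0ff706770df, 0xddd0fff07770fff,
    0x9bb075707bf0fff0, 0xab0b7607ff0f7b0f, 0xb0bb7077f0fff0ff, 0xbbb07770fff0fff].getD (4 * i + β) 0

/-- Bit `16 * e + 4 * e' + s` tells whether the leg of a spider with first edge of color `s` extends,
where `e` and `e'` are the colors of the other two edges at the center. -/
def legMask (i : Fin 6) (β : Fin 4) : ℕ :=
  [0x3330333033300000, 0x3303330300003303, 0x3033000030303003, 0x33303300303,
    0x5550555055500000, 0x5505550000005005, 0x5055000050555055, 0x55005550055,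
    0x9990999099900000, 0x9900990900000909, 0x9090000090990099, 0x99909990999,
    0x6660660060600000, 0x6606660600006606, 0x6066000060666066, 0x60600660666,
    0xaa00aaa00aa00000, 0xaa0aaa0a0000aa0a, 0xa00a000000aaa0aa, 0xaaa0aaa0aaa,
    0xc0c00cc0ccc00000, 0xc00c0c0c0000cc0c, 0xc0cc0000c0ccc0cc, 0xccc0ccc0ccc].getD (4 * i + β) 0

/-- The base-four digit with index `d` as a color. -/
def digit (n : ℕ) (d : ℕ) : Fin 4 := ⟨n / 4 ^ d % 4, Nat.mod_lt _ (by norm_num)⟩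

-- Only soundness of the table is needed: a set bit must yield an extension. Here `f` colors the
-- second edge of the arm, `p` and `q` the loops at its two vertices.
set_option synthInstance.maxHeartbeats 400000 in
set_option synthInstance.maxSize 2000 in
theorem armMask_spec : ∀ (i : Fin 6) (β : Fin 4), ∀ n < 64, (armMask i β).testBit n →
    digit n 2 ≠ β ∧ (∃ f, InPair i f ∧ f ≠ digit n 1 ∧ f ≠ digit n 0) ∧
    ∃ p, (p ≠ digit n 1 ∧ p ≠ digit n 0 ∧ p ≠ β) ∧
      ∃ q, InPair i q ∧ q ≠ digit n 2 ∧ q ≠ p := by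
  decide +kernel

set_option synthInstance.maxHeartbeats 400000 in
set_option synthInstance.maxSize 2000 in
theorem armMaskSwap_spec : ∀ (i : Fin 6) (β : Fin 4), ∀ n < 64, (armMaskSwap i β).testBit n →
    digit n 1 ≠ β ∧ (∃ f, InPair i f ∧ f ≠ digit n 2 ∧ f ≠ digit n 0) ∧
    ∃ p, (p ≠ digit n 2 ∧ p ≠ digit n 0 ∧ p ≠ β) ∧
      ∃ q, InPair i q ∧ q ≠ digit n 1 ∧ q ≠ p := by
  decide +kernel

set_option synthInstance.maxHeartbeats 400000 in
set_option synthInstance.maxSize 2000 in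
theorem legMask_spec : ∀ (i : Fin 6) (β : Fin 4), ∀ n < 64, (legMask i β).testBit n →
    (InPair i (digit n 0) ∧ digit n 2 ≠ β ∧ digit n 1 ≠ β) ∧
    ∃ p, InPair i p ∧ p ≠ digit n 2 ∧ p ≠ digit n 1 := by
  decide +kernel

theorem legMask_lt : ∀ (i : Fin 6) (β : Fin 4), legMask i β < 2 ^ 64 := by
  decide +kernel

/-- The arms and the leg interact only through the three colors at the center. Compatibility is thus
an intersection of three sets of triples, one bitwise conjunction for each boundary condition
instead of a search over ten colors. -/
theorem masks_ne_zero : ∀ (i : Fin 6) (α : Fin 4) (j : Fin 6) (β : Fin 4) (k : Fin 6) (γ : Fin 4),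
    armMask i α &&& armMaskSwap j β &&& legMask k γ ≠ 0 := by
  decide +kernel

theorem exists_spider_colors (i j k : Fin 6) (α β γ : Fin 4) :
    ∃ e₁ e₂ e₃ f₁ f₂ p₁ p₂ p₃ q₁ q₂ : Fin 4,
      (e₁ ≠ α ∧ (InPair i f₁ ∧ f₁ ≠ e₂ ∧ f₁ ≠ e₃) ∧ (p₁ ≠ e₂ ∧ p₁ ≠ e₃ ∧ p₁ ≠ α) ∧
        InPair i q₁ ∧ q₁ ≠ e₁ ∧ q₁ ≠ p₁) ∧
      (e₂ ≠ β ∧ (InPair j f₂ ∧ f₂ ≠ e₁ ∧ f₂ ≠ e₃) ∧ (p₂ ≠ e₁ ∧ p₂ ≠ e₃ ∧ p₂ ≠ β) ∧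
        InPair j q₂ ∧ q₂ ≠ e₂ ∧ q₂ ≠ p₂) ∧
      ((InPair k e₃ ∧ e₁ ≠ γ ∧ e₂ ≠ γ) ∧ InPair k p₃ ∧ p₃ ≠ e₁ ∧ p₃ ≠ e₂) := by
  obtain ⟨n, hn⟩ := Nat.exists_testBit_of_ne_zero (masks_ne_zero i α j β k γ)
  simp only [Nat.testBit_and, Bool.and_eq_true] at hn
  obtain ⟨⟨h₁, h₂⟩, h₃⟩ := hn
  -- A common bit is in particular a bit of the leg mask, which has only 64 bits.
  have hlt : n < 64 := by
    by_contra! h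
    rw [Nat.testBit_eq_false_of_lt ((legMask_lt k γ).trans_le (Nat.pow_le_pow_right two_pos h))]
      at h₃
    exact Bool.false_ne_true h₃
  obtain ⟨a₁, ⟨f₁, b₁⟩, p₁, c₁, q₁, d₁⟩ := armMask_spec i α n hlt h₁
  obtain ⟨a₂, ⟨f₂, b₂⟩, p₂, c₂, q₂, d₂⟩ := armMaskSwap_spec j β n hlt h₂
  obtain ⟨a₃, p₃, b₃⟩ := legMask_spec k γ n hlt h₃
  exact ⟨_, _, _, f₁, f₂, p₁, p₂, p₃, q₁, q₂, ⟨a₁, b₁, c₁, d₁⟩, ⟨a₂, b₂, c₂, d₂⟩, a₃, b₃⟩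

-- For a triangle `x v₁ v₂`: `e`, `e'` color the edges at `x`, `f` the edge `v₁ v₂`, `p`, `p'` the
-- loops at `v₁`, `v₂`, and `α` the third slot at `x`.
set_option synthInstance.maxHeartbeats 400000 in
set_option synthInstance.maxSize 2000 in
theorem exists_triangle_colors : ∀ (i : Fin 6) (α : Fin 4),
    ∃ e, InPair i e ∧ ∃ e', (InPair i e' ∧ e ≠ e') ∧ ∃ f, (f ≠ e ∧ f ≠ e' ∧ f ≠ α) ∧
    ∃ p, (p ≠ e' ∧ p ≠ α) ∧ ∃ p', p' ≠ e ∧ p' ≠ α ∧ p ≠ p' := by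
  decide +kernel

end FourColors

end SimpleGraph

namespace SimpleGraph

/-! ### Slot colorings and recoloring inside a deleted set -/

section Slots

variable {V : Type*} [Fintype V]

open scoped Classical in
/-- A slot at `a` is an edge at `a` or, if `a` has degree less than three, the loop `s(a, a)`, which
stands for pendant edges that may be added at `a`. -/
def HasSlot (H : SimpleGraph V) (a b : V) : Prop := H.Adj a b ∨ a = b ∧ H.degree a < 3

/-- The slots at `b` and at `y`, apart from the pair `s(b, y)`, have different colors. -/
def SeparatesAt (H : SimpleGraph V) (φ : Sym2 V → Fin 4) (b y : V) : Prop :=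
  ∀ a d, H.HasSlot b a → H.HasSlot y d → a ≠ y → d ≠ b → φ s(b, a) ≠ φ s(y, d)

/-- An injective coloring of the edges together with the loops at vertices of small degree. -/
def IsSlotColoring (H : SimpleGraph V) (φ : Sym2 V → Fin 4) : Prop :=
  ∀ b y, H.Adj b y → H.SeparatesAt φ b y

theorem SeparatesAt.symm {H : SimpleGraph V} {φ : Sym2 V → Fin 4} {b y : V}
    (h : H.SeparatesAt φ b y) : H.SeparatesAt φ y b :=
  fun a d ha hd hab hdy => (h d a hd ha hdy hab).symm

open scoped Classical in
/-- The color seen at `y ∉ D` on the slot towards `d`, if the edges to `D` get the color of the loop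
at `y`. -/
noncomputable def outerColor (D : Set V) (c : Sym2 V → Fin 4) (y d : V) : Fin 4 :=
  if d ∈ D then c s(y, y) else c s(y, d)

open scoped Classical in
/-- Recoloring by `ψ` inside `D`; an edge that leaves `D` gets the color of the loop at its end
outside `D`. -/
noncomputable def recolor (D : Set V) (c ψ : Sym2 V → Fin 4) : Sym2 V → Fin 4 :=
  Sym2.lift ⟨fun a b => if a ∈ D then if b ∈ D then ψ s(a, b) else c s(b, b) else outerColor D c a b,
    by
      intro a b
      by_cases ha : a ∈ D <;> by_cases hb : b ∈ D <;> simp [ha, hb, outerColor, Sym2.eq_swap]⟩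

variable {D : Set V} {c ψ : Sym2 V → Fin 4} {H : SimpleGraph V}

omit [Fintype V] in
theorem recolor_of_notMem {y : V} (hy : y ∉ D) (d : V) :
    recolor D c ψ s(y, d) = outerColor D c y d := by
  simp [recolor, hy]

omit [Fintype V] in
theorem recolor_of_mem_of_notMem {w y : V} (hw : w ∈ D) (hy : y ∉ D) :
    recolor D c ψ s(w, y) = c s(y, y) := by
  simp [recolor, hy, hw]

omit [Fintype V] in
theorem recolor_of_mem {v w : V} (hv : v ∈ D) (hw : w ∈ D) :
    recolor D c ψ s(v, w) = ψ s(v, w) := by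
  simp [recolor, hv, hw]

-- A vertex outside `D` with a neighbor in `D` has degree below three after the deletion, so its
-- loop was already separated from the slots across each surviving edge. Edges to `D` inherit that
-- color, so only separation at edges meeting `D` has to be checked.
open scoped Classical in
theorem IsSlotColoring.recolor (hd : ∀ x, H.degree x ≤ 3) (hc : (H.isolate D).IsSlotColoring c)
    (hψ : ∀ b ∈ D, ∀ y, H.Adj b y → H.SeparatesAt (recolor D c ψ) b y) :
    H.IsSlotColoring (recolor D c ψ) := by
  intro b y hby
  by_cases hb : b ∈ D
  · exact hψ b hb y hby
  by_cases hy : y ∈ D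
  · exact (hψ y hy b hby.symm).symm
  have key : ∀ v, v ∉ D → ∀ a, H.HasSlot v a → ∃ a', (H.isolate D).HasSlot v a' ∧
      outerColor D c v a = c s(v, a') ∧ (a' = a ∨ a' = v) := by
    intro v hv a ha
    by_cases haD : a ∈ D
    · have hva : H.Adj v a := ha.resolve_right fun h => hv (h.1 ▸ haD)
      refine ⟨v, Or.inr ⟨rfl, ?_⟩, by simp [outerColor, haD], Or.inr rfl⟩
      refine lt_of_lt_of_le (b := H.degree v) ?_ (hd v)
      rw [← card_neighborFinset_eq_degree, ← card_neighborFinset_eq_degree]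
      refine Finset.card_lt_card (Finset.ssubset_iff_of_subset ?_ |>.2 ⟨a, ?_, ?_⟩)
      · intro z hz
        rw [mem_neighborFinset] at hz ⊢
        exact hz.1
      · simpa using hva
      · rw [mem_neighborFinset]
        exact fun h => h.2.2 haD
    · refine ⟨a, ?_, by simp [outerColor, haD], Or.inl rfl⟩
      rcases ha with ha | ⟨rfl, ha⟩
      · exact Or.inl ⟨ha, hv, haD⟩
      · exact Or.inr ⟨rfl, (degree_le_of_le (H.isolate_le D)).trans_lt ha⟩
  intro a d ha hd' hay hdb
  obtain ⟨a', k₁, k₂, k₃⟩ := key b hb a ha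
  obtain ⟨d', l₁, l₂, l₃⟩ := key y hy d hd'
  rw [recolor_of_notMem hb, recolor_of_notMem hy, k₂, l₂]
  refine hc b y ⟨hby, hb, hy⟩ a' d' k₁ l₁ ?_ ?_
  · rcases k₃ with rfl | rfl
    · exact hay
    · exact hby.ne
  · rcases l₃ with rfl | rfl
    · exact hdb
    · exact hby.ne'

open scoped Classical in
theorem exists_adj_iff_of_degree_eq_three_of_adj {v u : V} (h : H.degree v = 3) (hu : H.Adj v u) :
    ∃ w z, u ≠ w ∧ u ≠ z ∧ w ≠ z ∧ ∀ a, H.Adj v a ↔ a = u ∨ a = w ∨ a = z := by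
  obtain ⟨a, b, d, hab, had, hbd, h⟩ := exists_adj_iff_of_degree_eq_three h
  rcases (h u).1 hu with rfl | rfl | rfl
  · exact ⟨b, d, hab, had, hbd, h⟩
  · exact ⟨a, d, hab.symm, hbd, had, fun x => (h x).trans (by tauto)⟩
  · exact ⟨a, b, had.symm, hbd.symm, hab, fun x => (h x).trans (by tauto)⟩

open scoped Classical in
/-- Apart from the edge to `b`, a vertex has at most two slots. -/
theorem exists_slots_of_adj {y b : V} (hd : H.degree y ≤ 3) (hyb : H.Adj y b) :
    ∃ d₁ d₂, ∀ d, H.HasSlot y d → d ≠ b → d = d₁ ∨ d = d₂ := by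
  have hpos := (H.degree_pos_iff_exists_adj y).2 ⟨b, hyb⟩
  obtain h | h | h : H.degree y = 1 ∨ H.degree y = 2 ∨ H.degree y = 3 := by omega
  · obtain ⟨u, hu⟩ := exists_adj_iff_of_degree_eq_one h
    refine ⟨y, y, fun d hd hdb => ?_⟩
    rcases hd with hd | hd
    · exact (hdb (((hu d).1 hd).trans ((hu b).1 hyb).symm)).elim
    · exact Or.inl hd.1.symm
  · obtain ⟨w, -, hw⟩ := exists_adj_iff_of_degree_eq_two_of_adj h hyb
    refine ⟨w, y, fun d hd hdb => ?_⟩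
    rcases hd with hd | hd
    · exact Or.inl (((hw d).1 hd).resolve_left hdb)
    · exact Or.inr hd.1.symm
  · obtain ⟨w, z, -, -, -, hw⟩ := exists_adj_iff_of_degree_eq_three_of_adj h hyb
    refine ⟨w, z, fun d hd hdb => ?_⟩
    rcases hd with hd | hd
    · exact ((hw d).1 hd).resolve_left hdb
    · omega

-- At most two slots of `y` remain, hence at most two forbidden colors, and two of the four colors
-- are free.
open scoped Classical in
theorem exists_pair_avoiding_outerColor {y b : V} (hd : H.degree y ≤ 3) (hyb : H.Adj y b)
    (D : Set V) (c : Sym2 V → Fin 4) :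
    ∃ i, ∀ d, H.HasSlot y d → d ≠ b → ∀ x, InPair i x → x ≠ outerColor D c y d := by
  obtain ⟨d₁, d₂, h⟩ := exists_slots_of_adj hd hyb
  obtain ⟨i, hi⟩ := exists_inPair_avoiding (outerColor D c y d₁) (outerColor D c y d₂)
  refine ⟨i, fun d hd hdb x hx => ?_⟩
  rcases h d hd hdb with rfl | rfl
  · exact (hi x hx).1
  · exact (hi x hx).2

/-- Separation at an edge that leaves `D`. -/
theorem separatesAt_boundary {w y : V} {i : Fin 6} (hy : y ∉ D)
    (hi : ∀ d, H.HasSlot y d → d ≠ w → ∀ x, InPair i x → x ≠ outerColor D c y d)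
    (hw : ∀ a, H.HasSlot w a → a ≠ y → InPair i (recolor D c ψ s(w, a))) :
    H.SeparatesAt (recolor D c ψ) w y := by
  intro a d ha hd hay hdw
  rw [recolor_of_notMem hy]
  exact hi d hd hdw _ (hw a ha hay)

theorem HasSlot.eq_or {v a : V} (h : H.HasSlot v a) {u : V} (hv : ∀ a, H.Adj v a ↔ a = u) :
    a = u ∨ a = v := by
  rcases h with h | h
  · exact Or.inl ((hv a).1 h)
  · exact Or.inr h.1.symm

theorem HasSlot.eq_or_or {v a : V} (h : H.HasSlot v a) {u w : V}
    (hv : ∀ a, H.Adj v a ↔ a = u ∨ a = w) : a = u ∨ a = w ∨ a = v := by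
  rcases h with h | h
  · rw [← or_assoc]
    exact Or.inl ((hv a).1 h)
  · exact Or.inr (Or.inr h.1.symm)

open scoped Classical in
theorem exists_isSlotColoring_of_leaf (hd : ∀ x, H.degree x ≤ 3) {v u : V}
    (hv : ∀ a, H.Adj v a ↔ a = u) (hc : ∃ c, (H.isolate {v}).IsSlotColoring c) :
    ∃ c, H.IsSlotColoring c := by
  obtain ⟨c, hc⟩ := hc
  have hvu : H.Adj v u := (hv u).2 rfl
  have hu : u ∉ ({v} : Set V) := hvu.ne'
  obtain ⟨i, hi⟩ := exists_pair_avoiding_outerColor (hd u) hvu.symm {v} c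
  refine ⟨_, hc.recolor hd (ψ := fun _ => pairFst i) ?_⟩
  rintro _ rfl y hy
  obtain rfl := (hv y).1 hy
  refine separatesAt_boundary hu hi fun a ha hau => ?_
  obtain rfl := (ha.eq_or hv).resolve_left hau
  rw [recolor_of_mem (Set.mem_singleton a) (Set.mem_singleton a)]
  exact Or.inl rfl

end Slots

end SimpleGraph

namespace SimpleGraph

/-! ### Reducible triangles and paths for four colors -/

section Configurations

variable {V : Type*} [Fintype V] {H : SimpleGraph V}

-- The vertex `z` stands for the third slot at `x`: an outside neighbor, or `x` itself when `x` has
-- degree two. Both cases use the same colors.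
open scoped Classical in
theorem exists_isSlotColoring_of_triangle (hd : ∀ x, H.degree x ≤ 3) {x v₁ v₂ z : V}
    (hx : ∀ a, H.HasSlot x a → a = v₁ ∨ a = v₂ ∨ a = z)
    (hv₁ : ∀ a, H.Adj v₁ a ↔ a = x ∨ a = v₂) (hv₂ : ∀ a, H.Adj v₂ a ↔ a = x ∨ a = v₁)
    (hz₁ : z ≠ v₁) (hz₂ : z ≠ v₂)
    (hc : ∃ c, (H.isolate {x, v₁, v₂}).IsSlotColoring c) :
    ∃ c, H.IsSlotColoring c := by
  obtain ⟨c, hc⟩ := hc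
  set D : Set V := {x, v₁, v₂} with hD
  have hxD : x ∈ D := by simp [hD]
  have hv₁D : v₁ ∈ D := by simp [hD]
  have hv₂D : v₂ ∈ D := by simp [hD]
  have hxv₁ : v₁ ≠ x := ((hv₁ x).2 (.inl rfl)).ne
  have hxv₂ : v₂ ≠ x := ((hv₂ x).2 (.inl rfl)).ne
  have hvv : v₁ ≠ v₂ := ((hv₁ v₂).2 (.inr rfl)).ne
  obtain ⟨i, hi⟩ : ∃ i, H.Adj x z → ∀ d, H.HasSlot z d → d ≠ x → ∀ t, InPair i t →
      t ≠ outerColor D c z d := by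
    by_cases h : H.Adj x z
    · obtain ⟨i, hi⟩ := exists_pair_avoiding_outerColor (hd z) h.symm D c
      exact ⟨i, fun _ => hi⟩
    -- Without an edge `x z` there is no boundary condition, and any pair will do.
    · exact ⟨0, fun h' => (h h').elim⟩
  obtain ⟨e, he, e', ⟨he', hee⟩, f, ⟨hf₁, hf₂, hf₃⟩, p, ⟨hp₁, hp₂⟩, p', hp₃, hp₄, hp₅⟩ :=
    exists_triangle_colors i (c s(z, z))
  let ψ : Sym2 V → Fin 4 := fun t =>
    if t = s(x, v₁) then e else if t = s(x, v₂) then e' else if t = s(v₁, v₂) then f else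
    if t = s(v₁, v₁) then p else if t = s(v₂, v₂) then p' else c s(z, z)
  have k₁ : recolor D c ψ s(x, v₁) = e := by
    rw [recolor_of_mem hxD hv₁D]; simp [ψ]
  have k₂ : recolor D c ψ s(x, v₂) = e' := by
    rw [recolor_of_mem hxD hv₂D]; simp [ψ, hvv.symm, hxv₁.symm]
  have k₃ : recolor D c ψ s(v₁, v₂) = f := by
    rw [recolor_of_mem hv₁D hv₂D]; simp [ψ, hvv.symm, hxv₁, hxv₂, hvv]
  have k₄ : recolor D c ψ s(v₁, v₁) = p := by
    rw [recolor_of_mem hv₁D hv₁D]; simp [ψ, hvv, hxv₁]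
  have k₅ : recolor D c ψ s(v₂, v₂) = p' := by
    rw [recolor_of_mem hv₂D hv₂D]; simp [ψ, hvv.symm, hxv₂]
  have k₆ : recolor D c ψ s(x, z) = c s(z, z) := by
    by_cases h : z ∈ D
    · obtain rfl : z = x := by simpa [hD, hz₁, hz₂] using h
      rw [recolor_of_mem hxD hxD]; simp [ψ, hxv₁.symm, hxv₂.symm]
    · exact recolor_of_mem_of_notMem hxD h
  have k₁' : recolor D c ψ s(v₁, x) = e := by rw [Sym2.eq_swap, k₁]
  have k₂' : recolor D c ψ s(v₂, x) = e' := by rw [Sym2.eq_swap, k₂]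
  have k₃' : recolor D c ψ s(v₂, v₁) = f := by rw [Sym2.eq_swap, k₃]
  have s₁ : H.SeparatesAt (recolor D c ψ) x v₁ := by
    intro a d ha hd' hay hdb
    rcases hx a ha with rfl | rfl | rfl <;> rcases hd'.eq_or_or hv₁ with rfl | rfl | rfl <;>
      simp_all [ne_comm]
  have s₂ : H.SeparatesAt (recolor D c ψ) x v₂ := by
    intro a d ha hd' hay hdb
    rcases hx a ha with rfl | rfl | rfl <;> rcases hd'.eq_or_or hv₂ with rfl | rfl | rfl <;>
      simp_all [ne_comm]
  have s₃ : H.SeparatesAt (recolor D c ψ) v₁ v₂ := by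
    intro a d ha hd' hay hdb
    rcases ha.eq_or_or hv₁ with rfl | rfl | rfl <;> rcases hd'.eq_or_or hv₂ with rfl | rfl | rfl <;>
      simp_all [ne_comm]
  refine ⟨_, hc.recolor hd (ψ := ψ) ?_⟩
  rintro b (rfl | rfl | rfl) y hy
  · rcases hx y (.inl hy) with rfl | rfl | rfl
    · exact s₁
    · exact s₂
    · refine separatesAt_boundary (i := i) (by simp [hD, hz₁, hz₂, hy.ne']) (hi hy)
        fun a ha hay => ?_
      rcases hx a ha with rfl | rfl | rfl
      · rwa [k₁]
      · rwa [k₂]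
      · exact (hay rfl).elim
  · rcases (hv₁ y).1 hy with rfl | rfl
    · exact s₁.symm
    · exact s₃
  · rcases (hv₂ y).1 hy with rfl | rfl
    · exact s₂.symm
    · exact s₃.symm

-- The ends `y₁` and `y₂` may coincide: `outerColor` already accounts for every edge from an outside
-- vertex back into `D`.
open scoped Classical in
theorem exists_isSlotColoring_of_path (hd : ∀ x, H.degree x ≤ 3) {y₁ v₁ v₂ v₃ y₂ : V}
    (hv₁ : ∀ a, H.Adj v₁ a ↔ a = y₁ ∨ a = v₂) (hv₂ : ∀ a, H.Adj v₂ a ↔ a = v₁ ∨ a = v₃)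
    (hv₃ : ∀ a, H.Adj v₃ a ↔ a = v₂ ∨ a = y₂) (h₁₃ : v₁ ≠ v₃)
    (hy₁ : y₁ ∉ ({v₁, v₂, v₃} : Set V)) (hy₂ : y₂ ∉ ({v₁, v₂, v₃} : Set V))
    (hc : ∃ c, (H.isolate {v₁, v₂, v₃}).IsSlotColoring c) :
    ∃ c, H.IsSlotColoring c := by
  obtain ⟨c, hc⟩ := hc
  set D : Set V := {v₁, v₂, v₃} with hD
  have hv₁D : v₁ ∈ D := by simp [hD]
  have hv₂D : v₂ ∈ D := by simp [hD]
  have hv₃D : v₃ ∈ D := by simp [hD]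
  have h₁₂ : v₁ ≠ v₂ := ((hv₁ v₂).2 (.inr rfl)).ne
  have h₂₃ : v₂ ≠ v₃ := ((hv₂ v₃).2 (.inr rfl)).ne
  obtain ⟨i, hi⟩ := exists_pair_avoiding_outerColor (hd y₁) ((hv₁ y₁).2 (.inl rfl)).symm D c
  obtain ⟨j, hj⟩ := exists_pair_avoiding_outerColor (hd y₂) ((hv₃ y₂).2 (.inr rfl)).symm D c
  obtain ⟨e, ⟨he₁, he₂⟩, e', ⟨he₁', he₂'⟩, p, ⟨hp₁, hp₂⟩, r, ⟨hr₁, hr₂⟩, q, hq₁, hq₂, hq₃, hq₄⟩ :=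
    exists_path_colors i j (c s(y₁, y₁)) (c s(y₂, y₂))
  let ψ : Sym2 V → Fin 4 := fun t =>
    if t = s(v₁, v₂) then e else if t = s(v₂, v₃) then e' else
    if t = s(v₁, v₁) then p else if t = s(v₃, v₃) then r else q
  have k₀ : recolor D c ψ s(v₁, y₁) = c s(y₁, y₁) := recolor_of_mem_of_notMem hv₁D hy₁
  have k₁ : recolor D c ψ s(v₁, v₂) = e := by
    rw [recolor_of_mem hv₁D hv₂D]; simp [ψ]
  have k₂ : recolor D c ψ s(v₂, v₃) = e' := by
    rw [recolor_of_mem hv₂D hv₃D]; simp [ψ, h₁₂.symm, h₁₃.symm]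
  have k₃ : recolor D c ψ s(v₃, y₂) = c s(y₂, y₂) := recolor_of_mem_of_notMem hv₃D hy₂
  have k₄ : recolor D c ψ s(v₁, v₁) = p := by
    rw [recolor_of_mem hv₁D hv₁D]; simp [ψ, h₁₂, h₁₃]
  have k₅ : recolor D c ψ s(v₂, v₂) = q := by
    rw [recolor_of_mem hv₂D hv₂D]; simp [ψ, h₁₂.symm, h₂₃]
  have k₆ : recolor D c ψ s(v₃, v₃) = r := by
    rw [recolor_of_mem hv₃D hv₃D]; simp [ψ, h₁₃.symm, h₂₃.symm]
  have k₁' : recolor D c ψ s(v₂, v₁) = e := by rw [Sym2.eq_swap, k₁]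
  have k₂' : recolor D c ψ s(v₃, v₂) = e' := by rw [Sym2.eq_swap, k₂]
  have s₁ : H.SeparatesAt (recolor D c ψ) v₁ v₂ := by
    intro a d ha hd' hay hdb
    rcases ha.eq_or_or hv₁ with rfl | rfl | rfl <;> rcases hd'.eq_or_or hv₂ with rfl | rfl | rfl <;>
      simp_all [ne_comm]
  have s₂ : H.SeparatesAt (recolor D c ψ) v₂ v₃ := by
    intro a d ha hd' hay hdb
    rcases ha.eq_or_or hv₂ with rfl | rfl | rfl <;> rcases hd'.eq_or_or hv₃ with rfl | rfl | rfl <;>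
      simp_all [ne_comm]
  refine ⟨_, hc.recolor hd (ψ := ψ) ?_⟩
  rintro b (rfl | rfl | rfl) y hy
  · rcases (hv₁ y).1 hy with rfl | rfl
    · refine separatesAt_boundary hy₁ hi fun a ha hay => ?_
      rcases (ha.eq_or_or hv₁).resolve_left hay with rfl | rfl
      · rwa [k₁]
      · rwa [k₄]
    · exact s₁
  · rcases (hv₂ y).1 hy with rfl | rfl
    · exact s₁.symm
    · exact s₂
  · rcases (hv₃ y).1 hy with rfl | rfl
    · exact s₂.symm
    · refine separatesAt_boundary hy₂ hj fun a ha hay => ?_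
      rcases ha.eq_or_or hv₃ with rfl | rfl | rfl
      · rwa [k₂']
      · exact (hay rfl).elim
      · rwa [k₆]

end Configurations

end SimpleGraph

namespace SimpleGraph

/-! ### The spider with two long arms and one short leg -/

section Spider

variable {V : Type*} [Fintype V] {H : SimpleGraph V}

theorem separatesAt_of_colors {φ : Sym2 V → Fin 4} {b y : V} {α β γ δ : Fin 4}
    (hb : ∀ a, H.HasSlot b a → a ≠ y → φ s(b, a) = α ∨ φ s(b, a) = β)
    (hy : ∀ d, H.HasSlot y d → d ≠ b → φ s(y, d) = γ ∨ φ s(y, d) = δ)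
    (h₁ : α ≠ γ) (h₂ : α ≠ δ) (h₃ : β ≠ γ) (h₄ : β ≠ δ) : H.SeparatesAt φ b y := by
  intro a d ha hd hay hdb
  rcases hb a ha hay with h | h <;> rcases hy d hd hdb with h' | h' <;> rwa [h, h']

theorem slot_colors_of_two {φ : Sym2 V → Fin 4} {v u w : V} {α β : Fin 4}
    (hv : ∀ a, H.Adj v a ↔ a = u ∨ a = w) (hw : φ s(v, w) = α) (hl : φ s(v, v) = β) :
    ∀ a, H.HasSlot v a → a ≠ u → φ s(v, a) = α ∨ φ s(v, a) = β := by
  intro a ha hau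
  rcases (ha.eq_or_or hv).resolve_left hau with h | h
  · exact Or.inl (h ▸ hw)
  · exact Or.inr (by rw [h, hl])

theorem slot_colors_of_three {φ : Sym2 V → Fin 4} {v u w z : V} {α β : Fin 4}
    (hv : ∀ a, H.HasSlot v a → a = u ∨ a = w ∨ a = z) (hw : φ s(v, w) = α) (hl : φ s(v, z) = β) :
    ∀ a, H.HasSlot v a → a ≠ u → φ s(v, a) = α ∨ φ s(v, a) = β := by
  intro a ha hau
  rcases (hv a ha).resolve_left hau with h | h
  · exact Or.inl (h ▸ hw)
  · exact Or.inr (h ▸ hl)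

-- The arms are `x v₁ w₁ y₁` and `x v₂ w₂ y₂`, the leg is `x v₃ y₃`. The center has no loop slot,
-- and the ends `yᵢ` need not be distinct.
open scoped Classical in
theorem exists_isSlotColoring_of_spider (hd : ∀ x, H.degree x ≤ 3)
    {x v₁ v₂ v₃ w₁ w₂ y₁ y₂ y₃ : V}
    (hnd : [x, v₁, v₂, v₃, w₁, w₂].Nodup)
    (hx : ∀ a, H.HasSlot x a → a = v₁ ∨ a = v₂ ∨ a = v₃)
    (hv₁ : ∀ a, H.Adj v₁ a ↔ a = x ∨ a = w₁) (hv₂ : ∀ a, H.Adj v₂ a ↔ a = x ∨ a = w₂)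
    (hv₃ : ∀ a, H.Adj v₃ a ↔ a = x ∨ a = y₃)
    (hw₁ : ∀ a, H.Adj w₁ a ↔ a = v₁ ∨ a = y₁) (hw₂ : ∀ a, H.Adj w₂ a ↔ a = v₂ ∨ a = y₂)
    (hy₁ : y₁ ∉ ({x, v₁, v₂, v₃, w₁, w₂} : Set V)) (hy₂ : y₂ ∉ ({x, v₁, v₂, v₃, w₁, w₂} : Set V))
    (hy₃ : y₃ ∉ ({x, v₁, v₂, v₃, w₁, w₂} : Set V))
    (hc : ∃ c, (H.isolate {x, v₁, v₂, v₃, w₁, w₂}).IsSlotColoring c) :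
    ∃ c, H.IsSlotColoring c := by
  obtain ⟨c, hc⟩ := hc
  set D : Set V := {x, v₁, v₂, v₃, w₁, w₂} with hD
  have hxD : x ∈ D := by simp [hD]
  have hv₁D : v₁ ∈ D := by simp [hD]
  have hv₂D : v₂ ∈ D := by simp [hD]
  have hv₃D : v₃ ∈ D := by simp [hD]
  have hw₁D : w₁ ∈ D := by simp [hD]
  have hw₂D : w₂ ∈ D := by simp [hD]
  obtain ⟨i, hi⟩ := exists_pair_avoiding_outerColor (hd y₁) ((hw₁ y₁).2 (.inr rfl)).symm D c
  obtain ⟨j, hj⟩ := exists_pair_avoiding_outerColor (hd y₂) ((hw₂ y₂).2 (.inr rfl)).symm D c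
  obtain ⟨k, hk⟩ := exists_pair_avoiding_outerColor (hd y₃) ((hv₃ y₃).2 (.inr rfl)).symm D c
  obtain ⟨e₁, e₂, e₃, f₁, f₂, p₁, p₂, p₃, q₁, q₂,
    ⟨a₁, ⟨a₂, a₃, a₄⟩, ⟨a₅, a₆, a₇⟩, a₈, a₉, a₁₀⟩, ⟨b₁, ⟨b₂, b₃, b₄⟩, ⟨b₅, b₆, b₇⟩, b₈, b₉, b₁₀⟩,
    ⟨d₁, d₂, d₃⟩, d₄, d₅, d₆⟩ :=
    exists_spider_colors i j k (c s(y₁, y₁)) (c s(y₂, y₂)) (c s(y₃, y₃))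
  let ψ : Sym2 V → Fin 4 := fun t =>
    if t = s(x, v₁) then e₁ else if t = s(x, v₂) then e₂ else if t = s(x, v₃) then e₃ else
    if t = s(v₁, w₁) then f₁ else if t = s(v₂, w₂) then f₂ else if t = s(v₁, v₁) then p₁ else
    if t = s(v₂, v₂) then p₂ else if t = s(v₃, v₃) then p₃ else if t = s(w₁, w₁) then q₁ else q₂
  obtain ⟨n₁, n₂, n₃, n₄, n₅⟩ : (x ≠ v₁ ∧ x ≠ v₂ ∧ x ≠ v₃ ∧ x ≠ w₁ ∧ x ≠ w₂) ∧
      (v₁ ≠ v₂ ∧ v₁ ≠ v₃ ∧ v₁ ≠ w₁ ∧ v₁ ≠ w₂) ∧ (v₂ ≠ v₃ ∧ v₂ ≠ w₁ ∧ v₂ ≠ w₂) ∧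
      (v₃ ≠ w₁ ∧ v₃ ≠ w₂) ∧ w₁ ≠ w₂ := by
    simpa using hnd
  have ke₁ : recolor D c ψ s(x, v₁) = e₁ := by
    rw [recolor_of_mem hxD hv₁D]; simp [ψ]
  have ke₂ : recolor D c ψ s(x, v₂) = e₂ := by
    rw [recolor_of_mem hxD hv₂D]; simp [ψ, n₁, n₂.1.symm]
  have ke₃ : recolor D c ψ s(x, v₃) = e₃ := by
    rw [recolor_of_mem hxD hv₃D]; simp [ψ, n₁, n₂.2.1.symm, n₃.1.symm]
  have kf₁ : recolor D c ψ s(v₁, w₁) = f₁ := by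
    rw [recolor_of_mem hv₁D hw₁D]; simp [ψ, n₁.1.symm, n₁.2.2.2.1.symm]
  have kf₂ : recolor D c ψ s(v₂, w₂) = f₂ := by
    rw [recolor_of_mem hv₂D hw₂D]; simp [ψ, n₁.2.1.symm, n₁.2.2.2.2.symm, n₂.1.symm, n₃]
  have kp₁ : recolor D c ψ s(v₁, v₁) = p₁ := by
    rw [recolor_of_mem hv₁D hv₁D]; simp [ψ, n₁.1.symm, n₂]
  have kp₂ : recolor D c ψ s(v₂, v₂) = p₂ := by
    rw [recolor_of_mem hv₂D hv₂D]; simp [ψ, n₁.2.1.symm, n₂.1.symm, n₃]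
  have kp₃ : recolor D c ψ s(v₃, v₃) = p₃ := by
    rw [recolor_of_mem hv₃D hv₃D]; simp [ψ, n₁.2.2.1.symm, n₂.2.1.symm, n₃.1.symm]
  have kq₁ : recolor D c ψ s(w₁, w₁) = q₁ := by
    rw [recolor_of_mem hw₁D hw₁D]
    simp [ψ, n₁.2.2.2.1.symm, n₂.2.2.1.symm, n₃.2.1.symm, n₄.1.symm]
  have kq₂ : recolor D c ψ s(w₂, w₂) = q₂ := by
    rw [recolor_of_mem hw₂D hw₂D]
    simp [ψ, n₁.2.2.2.2.symm, n₂.2.2.2.symm, n₃.2.2.symm, n₄.2.symm, n₅.symm]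
  have kg₁ : recolor D c ψ s(w₁, y₁) = c s(y₁, y₁) := recolor_of_mem_of_notMem hw₁D hy₁
  have kg₂ : recolor D c ψ s(w₂, y₂) = c s(y₂, y₂) := recolor_of_mem_of_notMem hw₂D hy₂
  have kg₃ : recolor D c ψ s(v₃, y₃) = c s(y₃, y₃) := recolor_of_mem_of_notMem hv₃D hy₃
  have ke₁' : recolor D c ψ s(v₁, x) = e₁ := by rw [Sym2.eq_swap, ke₁]
  have ke₂' : recolor D c ψ s(v₂, x) = e₂ := by rw [Sym2.eq_swap, ke₂]
  have ke₃' : recolor D c ψ s(v₃, x) = e₃ := by rw [Sym2.eq_swap, ke₃]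
  have kf₁' : recolor D c ψ s(w₁, v₁) = f₁ := by rw [Sym2.eq_swap, kf₁]
  have kf₂' : recolor D c ψ s(w₂, v₂) = f₂ := by rw [Sym2.eq_swap, kf₂]
  have sw : ∀ {v u w : V}, (∀ a, H.Adj v a ↔ a = u ∨ a = w) → ∀ a, H.Adj v a ↔ a = w ∨ a = u :=
    fun h a => (h a).trans or_comm
  have hx₂ : ∀ a, H.HasSlot x a → a = v₂ ∨ a = v₁ ∨ a = v₃ := fun a ha => or_left_comm.1 (hx a ha)
  have hx₃ : ∀ a, H.HasSlot x a → a = v₃ ∨ a = v₁ ∨ a = v₂ := fun a ha => by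
    have := hx a ha
    tauto
  have s₁ : H.SeparatesAt (recolor D c ψ) x v₁ :=
    separatesAt_of_colors (slot_colors_of_three hx ke₂ ke₃) (slot_colors_of_two hv₁ kf₁ kp₁)
      a₃.symm a₅.symm a₄.symm a₆.symm
  have s₂ : H.SeparatesAt (recolor D c ψ) x v₂ :=
    separatesAt_of_colors (slot_colors_of_three hx₂ ke₁ ke₃) (slot_colors_of_two hv₂ kf₂ kp₂)
      b₃.symm b₅.symm b₄.symm b₆.symm
  have s₃ : H.SeparatesAt (recolor D c ψ) x v₃ :=
    separatesAt_of_colors (slot_colors_of_three hx₃ ke₁ ke₂) (slot_colors_of_two hv₃ kg₃ kp₃)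
      d₂ d₅.symm d₃ d₆.symm
  have t₁ : H.SeparatesAt (recolor D c ψ) v₁ w₁ :=
    separatesAt_of_colors (slot_colors_of_two (sw hv₁) ke₁' kp₁) (slot_colors_of_two hw₁ kg₁ kq₁)
      a₁ a₉.symm a₇ a₁₀.symm
  have t₂ : H.SeparatesAt (recolor D c ψ) v₂ w₂ :=
    separatesAt_of_colors (slot_colors_of_two (sw hv₂) ke₂' kp₂) (slot_colors_of_two hw₂ kg₂ kq₂)
      b₁ b₉.symm b₇ b₁₀.symm
  have hout : ∀ {l : Fin 6} {t α β : Fin 4}, InPair l α → InPair l β → t = α ∨ t = β → InPair l t :=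
    fun h h' ht => by rcases ht with rfl | rfl <;> assumption
  have o₁ : H.SeparatesAt (recolor D c ψ) w₁ y₁ := separatesAt_boundary hy₁ hi fun a ha hay =>
    hout a₂ a₈ (slot_colors_of_two (sw hw₁) kf₁' kq₁ a ha hay)
  have o₂ : H.SeparatesAt (recolor D c ψ) w₂ y₂ := separatesAt_boundary hy₂ hj fun a ha hay =>
    hout b₂ b₈ (slot_colors_of_two (sw hw₂) kf₂' kq₂ a ha hay)
  have o₃ : H.SeparatesAt (recolor D c ψ) v₃ y₃ := separatesAt_boundary hy₃ hk fun a ha hay =>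
    hout d₁ d₄ (slot_colors_of_two (sw hv₃) ke₃' kp₃ a ha hay)
  refine ⟨_, hc.recolor hd (ψ := ψ) fun b hb y hy => ?_⟩
  simp only [hD, Set.mem_insert_iff, Set.mem_singleton_iff] at hb
  rcases hb with h | h | h | h | h | h <;> rw [h] at hy ⊢
  · rcases hx y (.inl hy) with h | h | h <;> rw [h]
    exacts [s₁, s₂, s₃]
  · rcases (hv₁ y).1 hy with h | h <;> rw [h]
    exacts [s₁.symm, t₁]
  · rcases (hv₂ y).1 hy with h | h <;> rw [h]
    exacts [s₂.symm, t₂]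
  · rcases (hv₃ y).1 hy with h | h <;> rw [h]
    exacts [s₃.symm, o₃]
  · rcases (hw₁ y).1 hy with h | h <;> rw [h]
    exacts [t₁.symm, o₁]
  · rcases (hw₂ y).1 hy with h | h <;> rw [h]
    exacts [t₂.symm, o₂]

end Spider

end SimpleGraph

namespace SimpleGraph

/-! ### Discharging below average degree 7/3 -/

section FourSparse

variable {V : Type*} [Fintype V]

open scoped Classical in
theorem exists_isSlotColoring {G : SimpleGraph V} (hd : ∀ x, G.degree x ≤ 3)
    (hG : G.maxAverageDegree < 7 / 3) : ∃ c, G.IsSlotColoring c := by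
  refine induction_of_isolate (G := G) (P := fun H => ∃ c, H.IsSlotColoring c) fun H hH ih => ?_
  have hdH : ∀ x, H.degree x ≤ 3 := fun x => (degree_le_of_le hH).trans (hd x)
  by_cases he : ∀ u v, ¬ H.Adj u v
  · exact ⟨fun _ => 0, fun b y h => (he b y h).elim⟩
  push Not at he
  obtain ⟨u, v, huv⟩ := he
  have hs := sum_degree_lt_of_maxAverageDegree_lt (p := 7) (q := 3) hH (by norm_num) hG huv
  by_contra hno
  have hc : ∀ {D : Set V} {x y}, x ∈ D → H.Adj x y → ∃ c, (H.isolate D).IsSlotColoring c :=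
    fun hx h => ih _ (isolate_lt hx h)
  have hdeg : ∀ x, H.degree x = 0 ∨ H.degree x = 2 ∨ H.degree x = 3 := by
    intro x
    have := hdH x
    by_cases h1 : H.degree x = 1
    · obtain ⟨z, hz⟩ := exists_adj_iff_of_degree_eq_one h1
      exact (hno (exists_isSlotColoring_of_leaf hdH hz
        (hc (Set.mem_singleton x) ((hz z).2 rfl)))).elim
    · omega
  have hdeg' : ∀ x y, H.Adj x y → H.degree x = 2 ∨ H.degree x = 3 := fun x y h =>
    (hdeg x).resolve_left ((H.degree_pos_iff_exists_adj x).2 ⟨y, h⟩).ne'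
  -- Triangles come first: excluding them keeps the ends of paths and spiders outside the deleted
  -- set.
  have htri : ∀ x v₁ v₂, H.Adj v₁ x → H.Adj v₂ x → H.Adj v₁ v₂ → H.degree v₁ = 2 →
      H.degree v₂ = 2 → False := by
    intro x v₁ v₂ h₁ h₂ h₁₂ k₁ k₂
    have adj_iff : ∀ {a b}, H.Adj a x → H.Adj a b → b ≠ x → H.degree a = 2 →
        ∀ t, H.Adj a t ↔ t = x ∨ t = b := by
      intro a b hax hab hbx ha
      obtain ⟨w, -, hw⟩ := exists_adj_iff_of_degree_eq_two_of_adj ha hax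
      obtain rfl := ((hw b).1 hab).resolve_left hbx
      exact hw
    have hN₁ := adj_iff h₁ h₁₂ h₂.ne k₁
    have hN₂ := adj_iff h₂ h₁₂.symm h₁.ne k₂
    have hcD := hc (D := {x, v₁, v₂}) (by simp) h₁.symm
    rcases hdeg' x v₁ h₁.symm with hx | hx
    · obtain ⟨w, hvw, hw⟩ := exists_adj_iff_of_degree_eq_two_of_adj hx h₁.symm
      obtain rfl := ((hw v₂).1 h₂.symm).resolve_left h₁₂.ne'
      exact hno (exists_isSlotColoring_of_triangle hdH (fun a ha => ha.eq_or_or hw) hN₁ hN₂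
        h₁.ne' h₂.ne' hcD)
    · obtain ⟨a, b, h1, h2, h3, hN⟩ := exists_adj_iff_of_degree_eq_three_of_adj hx h₁.symm
      have hslot : ∀ t, H.HasSlot x t → t = v₁ ∨ t = a ∨ t = b := fun t ht =>
        (hN t).1 (ht.resolve_right fun h => by omega)
      rcases ((hN v₂).1 h₂.symm).resolve_left h₁₂.ne' with rfl | rfl
      · exact hno (exists_isSlotColoring_of_triangle hdH hslot hN₁ hN₂ h2.symm h3.symm hcD)
      · exact hno (exists_isSlotColoring_of_triangle hdH
          (fun t ht => by have := hslot t ht; tauto) hN₁ hN₂ h1.symm h3 hcD)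
  have hpath : ∀ v₁ v₂ v₃, H.Adj v₁ v₂ → H.Adj v₂ v₃ → v₁ ≠ v₃ → H.degree v₁ = 2 →
      H.degree v₂ = 2 → H.degree v₃ = 2 → False := by
    intro v₁ v₂ v₃ h₁₂ h₂₃ h₁₃ k₁ k₂ k₃
    have hn : ¬ H.Adj v₁ v₃ := fun h => htri v₂ v₁ v₃ h₁₂ h₂₃.symm h k₁ k₃
    obtain ⟨y₁, hy₁, hN₁⟩ := exists_adj_iff_of_degree_eq_two_of_adj k₁ h₁₂
    obtain ⟨w, hw, hN₂⟩ := exists_adj_iff_of_degree_eq_two_of_adj k₂ h₁₂.symm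
    obtain rfl := ((hN₂ v₃).1 h₂₃).resolve_left h₁₃.symm
    obtain ⟨y₂, hy₂, hN₃⟩ := exists_adj_iff_of_degree_eq_two_of_adj k₃ h₂₃.symm
    have hvy₁ : H.Adj v₁ y₁ := (hN₁ y₁).2 (.inr rfl)
    have hvy₂ : H.Adj v₃ y₂ := (hN₃ y₂).2 (.inr rfl)
    refine hno (exists_isSlotColoring_of_path hdH (fun a => (hN₁ a).trans or_comm) hN₂ hN₃ h₁₃
      ?_ ?_ (hc (D := {v₁, v₂, v₃}) (by simp) h₁₂))
    · rintro (rfl | rfl | rfl)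
      · exact hvy₁.ne rfl
      · exact hy₁ rfl
      · exact hn hvy₁
    · rintro (rfl | rfl | rfl)
      · exact hn hvy₂.symm
      · exact hy₂ rfl
      · exact hvy₂.ne rfl
  have hspider : ∀ x v₁ v₂ v₃ w₁ w₂, H.degree x = 3 → H.Adj x v₁ → H.Adj x v₂ → H.Adj x v₃ →
      v₁ ≠ v₂ → v₁ ≠ v₃ → v₂ ≠ v₃ → H.degree v₁ = 2 → H.degree v₂ = 2 → H.degree v₃ = 2 →
      H.Adj v₁ w₁ → H.Adj v₂ w₂ → H.degree w₁ = 2 → H.degree w₂ = 2 → False := by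
    intro x v₁ v₂ v₃ w₁ w₂ hx hxv₁ hxv₂ hxv₃ h₁₂ h₁₃ h₂₃ k₁ k₂ k₃ hvw₁ hvw₂ l₁ l₂
    have hslot : ∀ t, H.HasSlot x t → t = v₁ ∨ t = v₂ ∨ t = v₃ := by
      intro t ht
      have ht' := ht.resolve_right fun h => by omega
      obtain ⟨a, b, h1, h2, h3, hN⟩ := exists_adj_iff_of_degree_eq_three_of_adj hx hxv₁
      have m₂ := ((hN v₂).1 hxv₂).resolve_left h₁₂.symm
      have m₃ := ((hN v₃).1 hxv₃).resolve_left h₁₃.symm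
      have := (hN t).1 ht'
      rcases m₂ with rfl | rfl <;> rcases m₃ with rfl | rfl <;> tauto
    have nadj₁₂ : ¬ H.Adj v₁ v₂ := fun h => htri x v₁ v₂ hxv₁.symm hxv₂.symm h k₁ k₂
    have nadj₁₃ : ¬ H.Adj v₁ v₃ := fun h => htri x v₁ v₃ hxv₁.symm hxv₃.symm h k₁ k₃
    have nadj₂₃ : ¬ H.Adj v₂ v₃ := fun h => htri x v₂ v₃ hxv₂.symm hxv₃.symm h k₂ k₃
    have ne_of_degree : ∀ {a}, H.degree a = 2 → a ≠ x := by
      rintro a ha rfl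
      omega
    have other : ∀ {a b c}, H.degree a = 2 → H.Adj a b → H.Adj a c → c ≠ b →
        ∀ t, H.Adj a t ↔ t = b ∨ t = c := by
      intro a b c ha hab hac hcb
      obtain ⟨w, -, hw⟩ := exists_adj_iff_of_degree_eq_two_of_adj ha hab
      obtain rfl := ((hw c).1 hac).resolve_left hcb
      exact hw
    have hN₁ := other k₁ hxv₁.symm hvw₁ (ne_of_degree l₁)
    have hN₂ := other k₂ hxv₂.symm hvw₂ (ne_of_degree l₂)
    obtain ⟨y₃, hy₃, hN₃⟩ := exists_adj_iff_of_degree_eq_two_of_adj k₃ hxv₃.symm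
    obtain ⟨y₁, hy₁, hM₁⟩ := exists_adj_iff_of_degree_eq_two_of_adj l₁ hvw₁.symm
    obtain ⟨y₂, hy₂, hM₂⟩ := exists_adj_iff_of_degree_eq_two_of_adj l₂ hvw₂.symm
    have hvy₃ : H.Adj v₃ y₃ := (hN₃ y₃).2 (.inr rfl)
    have hwy₁ : H.Adj w₁ y₁ := (hM₁ y₁).2 (.inr rfl)
    have hwy₂ : H.Adj w₂ y₂ := (hM₂ y₂).2 (.inr rfl)
    have w₁v₂ : w₁ ≠ v₂ := by rintro rfl; exact nadj₁₂ hvw₁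
    have w₁v₃ : w₁ ≠ v₃ := by rintro rfl; exact nadj₁₃ hvw₁
    have w₂v₁ : w₂ ≠ v₁ := by rintro rfl; exact nadj₁₂ hvw₂.symm
    have w₂v₃ : w₂ ≠ v₃ := by rintro rfl; exact nadj₂₃ hvw₂
    have w₁w₂ : w₁ ≠ w₂ := by rintro rfl; exact hpath v₁ w₁ v₂ hvw₁ hvw₂.symm h₁₂ k₁ l₁ k₂
    have adj_center : ∀ {a}, H.Adj x a → a = v₁ ∨ a = v₂ ∨ a = v₃ := fun h => hslot _ (.inl h)
    refine hno (exists_isSlotColoring_of_spider (w₁ := w₁) (w₂ := w₂) hdH ?_ hslot hN₁ hN₂ hN₃ hM₁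
      hM₂ ?_ ?_ ?_ (hc (D := {x, v₁, v₂, v₃, w₁, w₂}) (by simp) hxv₁))
    · simp [hxv₁.ne, hxv₂.ne, hxv₃.ne, (ne_of_degree l₁).symm, (ne_of_degree l₂).symm, h₁₂, h₁₃,
        h₂₃, hvw₁.ne, hvw₂.ne, w₁v₂.symm, w₁v₃.symm, w₂v₁.symm, w₂v₃.symm, w₁w₂]
    · rintro (rfl | rfl | rfl | rfl | rfl | rfl)
      · rcases adj_center hwy₁.symm with h | h | h
        exacts [hvw₁.ne h.symm, w₁v₂ h, w₁v₃ h]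
      · exact hy₁ rfl
      · exact hpath _ _ _ hvw₁ hwy₁ h₁₂ k₁ l₁ k₂
      · exact hpath _ _ _ hvw₁ hwy₁ h₁₃ k₁ l₁ k₃
      · exact hwy₁.ne rfl
      · exact hpath _ _ _ hvw₁ hwy₁ w₂v₁.symm k₁ l₁ l₂
    · rintro (rfl | rfl | rfl | rfl | rfl | rfl)
      · rcases adj_center hwy₂.symm with h | h | h
        exacts [w₂v₁ h, hvw₂.ne h.symm, w₂v₃ h]
      · exact hpath _ _ _ hvw₂ hwy₂ h₁₂.symm k₂ l₂ k₁
      · exact hy₂ rfl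
      · exact hpath _ _ _ hvw₂ hwy₂ h₂₃ k₂ l₂ k₃
      · exact hpath _ _ _ hvw₂ hwy₂ w₁v₂.symm k₂ l₂ l₁
      · exact hwy₂.ne rfl
    · rintro (rfl | rfl | rfl | rfl | rfl | rfl)
      · exact hy₃ rfl
      · exact nadj₁₃ hvy₃.symm
      · exact nadj₂₃ hvy₃.symm
      · exact hvy₃.ne rfl
      · exact hpath _ _ _ hvw₁ hvy₃.symm h₁₃ k₁ l₁ k₃
      · exact hpath _ _ _ hvw₂ hvy₃.symm h₂₃ k₂ l₂ k₃
  obtain ⟨hsum, hcard⟩ := sum_degree_eq_of_forall hdeg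
  -- Discharging rule: a 2-vertex `w` sends `r w` to each 3-neighbor, double if it has a 2-neighbor.
  -- As three 2-vertices never form a path, it sends at least two in all.
  let r : V → ℕ := fun w => if ∃ t, H.Adj w t ∧ H.degree t = 2 then 2 else 1
  have hr1 : ∀ w, 1 ≤ r w := fun w => by simp only [r]; split_ifs <;> omega
  have hr2 : ∀ w, r w ≤ 2 := fun w => by simp only [r]; split_ifs <;> omega
  set N₂ := Finset.univ.filter fun v => H.degree v = 2 with hN₂
  set N₃ := Finset.univ.filter fun v => H.degree v = 3 with hN₃
  have hgive : ∀ w ∈ N₂, 2 ≤ ∑ x ∈ N₃ with H.Adj w x, r w := by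
    intro w hw
    have hw2 : H.degree w = 2 := by simpa [hN₂] using hw
    obtain ⟨a, b, hab, hN⟩ := exists_adj_iff_of_degree_eq_two hw2
    have hwa := (hN a).2 (.inl rfl)
    have hwb := (hN b).2 (.inr rfl)
    have mem : ∀ {t}, H.Adj w t → H.degree t = 3 → t ∈ N₃.filter (H.Adj w) := fun h h' => by
      simp [hN₃, h, h']
    rw [Finset.sum_const, smul_eq_mul]
    have one : ∀ {t}, H.Adj w t → H.degree t = 3 → 1 ≤ (N₃.filter (H.Adj w)).card := fun h h' =>
      Finset.card_pos.2 ⟨_, mem h h'⟩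
    have two : ∀ {t}, H.Adj w t → H.degree t = 2 → r w = 2 := fun h h' => if_pos ⟨_, h, h'⟩
    rcases hdeg' a w hwa.symm with ha | ha
    · rcases hdeg' b w hwb.symm with hb | hb
      · exact (hpath a w b hwa.symm hwb hab ha hw2 hb).elim
      · exact Nat.mul_le_mul (one hwb hb) (two hwa ha).ge
    · rcases hdeg' b w hwb.symm with hb | hb
      · exact Nat.mul_le_mul (one hwa ha) (two hwb hb).ge
      · have h2 : 1 < (N₃.filter (H.Adj w)).card :=
          Finset.one_lt_card.2 ⟨a, mem hwa ha, b, mem hwb hb, hab⟩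
        have := Nat.mul_le_mul h2 (hr1 w)
        omega
  -- More than four would require three 2-neighbors, two of them sending double, which is a spider.
  have hreceive : ∀ x ∈ N₃, ∑ w ∈ N₂ with H.Adj w x, r w ≤ 4 := by
    intro x hx
    have hx3 : H.degree x = 3 := by simpa [hN₃] using hx
    obtain ⟨a, b, d, hab, had, hbd, hN⟩ := exists_adj_iff_of_degree_eq_three hx3
    have hxa := (hN a).2 (.inl rfl)
    have hxb := (hN b).2 (.inr (.inl rfl))
    have hxd := (hN d).2 (.inr (.inr rfl))
    have hset : N₂.filter (fun w => H.Adj w x) =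
        ({a, b, d} : Finset V).filter fun w => H.degree w = 2 := by
      ext w
      simp only [hN₂, Finset.mem_filter, Finset.mem_univ, true_and, H.adj_comm w x, hN,
        Finset.mem_insert, Finset.mem_singleton]
      tauto
    rw [hset, Finset.sum_filter, Finset.sum_insert (by simp [hab, had]),
      Finset.sum_insert (by simp [hbd]), Finset.sum_singleton]
    have h2a := hr2 a
    have h2b := hr2 b
    have h2d := hr2 d
    have key : ∀ {p q s}, H.Adj x p → H.Adj x q → H.Adj x s → p ≠ q → p ≠ s → q ≠ s →
        H.degree p = 2 → H.degree q = 2 → H.degree s = 2 → r p = 2 → r q = 2 → False := by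
      intro p q s hp hq hs hpq hps hqs dp dq ds rp rq
      have ex : ∀ {t}, r t = 2 → ∃ w, H.Adj t w ∧ H.degree w = 2 := by
        intro t ht
        by_contra h
        simp [r, h] at ht
      obtain ⟨w₁, hw₁, hw₁'⟩ := ex rp
      obtain ⟨w₂, hw₂, hw₂'⟩ := ex rq
      exact hspider x p q s w₁ w₂ hx3 hp hq hs hpq hps hqs dp dq ds hw₁ hw₂ hw₁' hw₂'
    by_cases ha : H.degree a = 2 <;> by_cases hb : H.degree b = 2 <;>
      by_cases hd' : H.degree d = 2 <;> simp only [ha, hb, hd', if_true, if_false] <;> try omega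
    by_contra! h
    have : ¬ (r a = 2 ∧ r b = 2) := fun h =>
      @key a b d hxa hxb hxd hab had hbd ha hb hd' h.1 h.2
    have : ¬ (r a = 2 ∧ r d = 2) := fun h =>
      @key a d b hxa hxd hxb had hab hbd.symm ha hd' hb h.1 h.2
    have : ¬ (r b = 2 ∧ r d = 2) := fun h =>
      @key b d a hxb hxd hxa hbd hab.symm had.symm hb hd' ha h.1 h.2
    omega
  have hcount : N₂.card * 2 ≤ N₃.card * 4 := by
    calc N₂.card * 2 = ∑ w ∈ N₂, 2 := by simp
      _ ≤ ∑ w ∈ N₂, ∑ x ∈ N₃ with H.Adj w x, r w := Finset.sum_le_sum hgive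
      _ = ∑ x ∈ N₃, ∑ w ∈ N₂ with H.Adj w x, r w := by
        simp only [Finset.sum_filter]
        exact Finset.sum_comm
      _ ≤ ∑ x ∈ N₃, 4 := Finset.sum_le_sum hreceive
      _ = N₃.card * 4 := by simp
  -- `n₂ ≤ 2 n₃` contradicts `3 (2 n₂ + 3 n₃) < 7 (n₂ + n₃)`.
  omega

end FourSparse

end SimpleGraph

theorem theorem1p16 {V : Type*} [Fintype V] (G : SimpleGraph V) [DecidableRel G.Adj]
    (hG : G.maxDegree ≤ 3) :
    (G.maxAverageDegree < 7 / 3 → G.injectiveChromaticIndex ≤ 4) ∧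
    (G.maxAverageDegree < 8 / 3 → G.injectiveChromaticIndex ≤ 6) ∧
    (G.maxAverageDegree < 3 → G.injectiveChromaticIndex ≤ 7) := by
  classical
  have hd : ∀ x, @SimpleGraph.degree V G x (Subtype.fintype _) ≤ 3 := fun x => by
    refine le_trans (le_of_eq ?_) ((G.degree_le_maxDegree x).trans hG)
    congr!
  have of_colorsOn : ∀ {k : ℕ}, (∃ c : Sym2 V → Fin k, G.ColorsOn G.edgeSet c) →
      G.injectiveChromaticIndex ≤ k := fun ⟨c, hc⟩ => SimpleGraph.injectiveChromaticIndex_le c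
    fun a b x y h₁ h₂ h₃ h₄ h₅ => hc _ h₁ _ h₃ ⟨a, b, x, y, h₁, h₂, h₃, h₄, h₅, rfl, rfl⟩
  refine ⟨fun h => ?_, fun h => ?_, fun h => ?_⟩
  · obtain ⟨c, hc⟩ := SimpleGraph.exists_isSlotColoring (fun x => by convert hd x) h
    refine SimpleGraph.injectiveChromaticIndex_le c fun a b x y h₁ h₂ h₃ h₄ h₅ => ?_
    -- Separation is applied at the middle edge `b x`, with the outer edges as slots at `b` and `x`.
    rw [Sym2.eq_swap]
    exact hc b x h₂ a y (.inl h₁.symm) (.inl h₃) h₄ h₅.symm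
  · exact of_colorsOn (SimpleGraph.exists_colorsOn_six (fun x => by convert hd x) h)
  · exact of_colorsOn (SimpleGraph.exists_colorsOn_seven (fun x => by convert hd x) h)
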